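/- For a graph $G$, let $G^{(k)}$ denote its $k$-core, i.e. the (unique, possibly empty) maximal subgraph of $G$ of minimum degree at least $k$. There is a $k_0$ such that for every integer $k \geq k_0$ the following holds. Let $c=c(n)$ be any sequence of reals satisfying $$k+99\sqrt{k\log k}\;\leq\; c(n)\;\leq\; 2\log n$$ for all large enough $n$ (natural logarithms), and put $m=m(n)=\lfloor c(n)\,n/2\rfloor$. Let $H\sim\mathcal{G}(n,m)$ be a uniformly chosen graph on $n$ labeled vertices with exactly $m$ edges, and let $G$ be the graph obtained from $H$ by adding $n$ uniformly distributed new edges (a uniformly random set of $n$ non-edges of $H$). Then, as $n\to\infty$, the probability that $H^{(k)}$ contains a family of $\lfloor (k-3)/2\rfloor$ edge-disjoint Hamilton cycles (of $H^{(k)}$), and at the same time $G^{(k)}$ does not contain a family of $\lfloor (k-3)/2\rfloor$ edge-disjoint Hamilton cycles (of $G^{(k)}$), is $o(n^{-2})$. -/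

import Mathlib

open Filter Asymptotics

noncomputable section

namespace CorePacking

open Classical in
/-- The uniform distribution on a nonempty subset `s` of a finite type. If `s` is empty, this is
the point mass at the default value `a`. -/
def uniformOr {α : Type*} [Finite α] (s : Set α) (a : α) : PMF α :=
  if h : s.toFinite.toFinset.Nonempty then PMF.uniformOfFinset s.toFinite.toFinset h
  else PMF.pure a

/-- The random graph `𝒢(n, m)`: uniform among all graphs on the vertex set `Fin n` with exactly
`m` edges (for `m ≤ n.choose 2`; the default value for larger `m` is immaterial). -/
def gnm (n m : ℕ) : PMF (SimpleGraph (Fin n)) :=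
  uniformOr {G | G.edgeSet.ncard = m} ⊤

/-- The graph obtained from `H` by adding `r` new edges: the set of added edges is uniform among
all `r`-element sets of non-edges of `H` (if `H` has at least `r` non-edges; otherwise the default
value is immaterial). -/
def addRandomEdges {n : ℕ} (H : SimpleGraph (Fin n)) (r : ℕ) : PMF (SimpleGraph (Fin n)) :=
  uniformOr {G | H ≤ G ∧ (G.edgeSet \ H.edgeSet).ncard = r} ⊤

/-- The joint law of `(H, G)`, where `H ∼ 𝒢(n, m)` and `G` is `H` together with `r` uniformly
distributed new edges. -/
def sprinkledPair (n m r : ℕ) : PMF (SimpleGraph (Fin n) × SimpleGraph (Fin n)) :=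
  (gnm n m).bind fun H => (addRandomEdges H r).map fun G => (H, G)

/-- The subgraph `K` has minimum degree at least `k` (vacuously true for the empty subgraph). -/
def MinDegreeGE {V : Type*} {G : SimpleGraph V} (K : G.Subgraph) (k : ℕ) : Prop :=
  ∀ v ∈ K.verts, (k : ℕ∞) ≤ (K.neighborSet v).encard

/-- The `k`-core of `G`: its largest subgraph of minimum degree at least `k` (possibly empty);
see `kCore_isGreatest`. -/
def kCore {V : Type*} (G : SimpleGraph V) (k : ℕ) : G.Subgraph :=
  sSup {K | MinDegreeGE K k}

theorem kCore_isGreatest {V : Type*} (G : SimpleGraph V) (k : ℕ) :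
    IsGreatest {K : G.Subgraph | MinDegreeGE K k} (kCore G k) := by
  refine ⟨?_, fun K hK => le_sSup hK⟩
  intro v hv
  simp only [kCore, SimpleGraph.Subgraph.verts_sSup, Set.mem_iUnion] at hv
  obtain ⟨K, hK, hv⟩ := hv
  exact (hK v hv).trans
    (Set.encard_le_encard fun w hw => (le_sSup (a := K) hK : K ≤ kCore G k).2 hw)

open Classical in
/-- `G` contains a family of `r` pairwise edge-disjoint Hamilton cycles. -/
def HasEdgeDisjointHamiltonCycles {V : Type*} (G : SimpleGraph V) (r : ℕ) : Prop :=
  ∃ (v : Fin r → V) (C : ∀ i, G.Walk (v i) (v i)),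
    (∀ i, (C i).IsHamiltonianCycle) ∧
      Pairwise fun i j => Disjoint {e | e ∈ (C i).edges} {e | e ∈ (C j).edges}

/-- The `k`-core of `G` contains a family of `⌊(k - 3) / 2⌋` edge-disjoint Hamilton cycles
(each spanning the core). -/
def CoreHasPacking {V : Type*} (G : SimpleGraph V) (k : ℕ) : Prop :=
  HasEdgeDisjointHamiltonCycles (kCore G k).coe ((k - 3) / 2)

/-- The probability that the `k`-core of `H` contains `⌊(k - 3) / 2⌋` edge-disjoint Hamilton cycles
and the `k`-core of `G` does not, where `H ∼ 𝒢(n, m)` and `G` is `H` together with `n` uniformly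
distributed new edges. -/
def packingLossProb (k n m : ℕ) : ℝ :=
  ((sprinkledPair n m n).toOuterMeasure
    {p | CoreHasPacking p.1 k ∧ ¬ CoreHasPacking p.2 k}).toReal

end CorePacking

end

/-!
The random graph `G` arises from `H` by `n` random edges, and the core `W` of `H` is contained in
the core `X` of `G`. Write `r = ⌊(k - 3) / 2⌋` and `c ≈ 2 m / n`. The Hamilton cycles of `W`, each
with one edge removed, are `r` edge-disjoint paths that nearly span `X`; the new edges are used to
turn them, one improvement at a time, into Hamilton cycles of `X`.

* *`X` is hardly larger than `W`.* If `W` misses more than `D` vertices, then successive deletion of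
  vertices of degree below `k` produces a set of `D + 1` vertices that meets at most `k (D + 1)`
  edges, noticeably fewer than the expected `c (D + 1)`. As `c - k ≥ 99 √(k log k)`, a first moment
  computation rules this out for `D = n / c ^ 71`, up to an exponentially small probability
  (`CorePacking.exists_peeled`, `CorePacking.card_small_core_le`,
  `CorePacking.log_le_chernoff_exponent`).
* *Expansion.* With probability `1 - O(c ^ 33 / n ^ 3)` no set of `t ≤ n / c ^ 34` vertices of `G`
  spans `t + 3 + ⌊t / 16⌋` or more edges (`CorePacking.card_not_locallySparse_le`). The core has
  minimum degree at least `k ≥ 2 r + 3`, so after the removal of `r - 1` edge-disjoint paths or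
  cycles the degrees in `X` are still at least five; by sparsity, all sets of up to about `n / (3 c
  ^ 34)` vertices then have at least twice as many outer neighbours
  (`CorePacking.expansion_of_sparse`).
* *Boosters.* Take a family of edge-disjoint paths and Hamilton cycles in `X` of largest total
  length, and a member that is not a Hamilton cycle. By Pósa rotations, performed while avoiding the
  edges of the other members, that path can be replaced by paths of the same length with
  quadratically many pairs of end vertices (`CorePacking.exists_endpoint_pairs`). An edge joining
  such a pair closes a cycle, which is Hamiltonian or, by expansion, can be opened to a longer path.
  A fraction of order `c ^ (-68)` of all pairs inside `W` therefore improves the family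
  (`CorePacking.HasTracks.improve`).
* *Sprinkling.* Fewer than half of the new edges leave `W`, and these are exposed first. They
  determine the vertex set of `X`, because edges inside `W` do not change that of the core any more
  (`CorePacking.coreSet_eq_of_le`). The remaining edges, at least `n / 2` in number, form a random
  set of pairs inside `W`. About `k D / 2` improvements are needed, and of order `n / c ^ 68` are
  expected, so that a failure is exponentially unlikely (`CorePacking.card_fail_le`,
  `CorePacking.card_sprinkle_fail_le`).

Since `c ≤ 2 log n`, the sum of the failure probabilities is of smaller order than `n ^ (-2)`. All
probabilities are handled as ratios of numbers of edge sets, see `CorePacking.packingLossProb_eq`.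
-/

namespace CorePacking

open Finset

/-! ### Counting subsets of a finite set -/

/-- Choosing a set of size `t + 1` together with one of its elements amounts to choosing the
element first. -/
theorem sum_powersetCard_succ {α β : Type*} [DecidableEq α] [AddCommMonoid β] (U : Finset α)
    (t : ℕ) (g : Finset α → α → β) :
    ∑ F ∈ U.powersetCard (t + 1), ∑ e ∈ F, g F e =
      ∑ e ∈ U, ∑ F ∈ (U.erase e).powersetCard t, g (insert e F) e := by
  rw [Finset.sum_sigma', Finset.sum_sigma']
  refine Finset.sum_bij' (fun p _ => ⟨p.2, p.1.erase p.2⟩) (fun p _ => ⟨insert p.1 p.2, p.1⟩)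
    ?_ ?_ ?_ ?_ ?_
  · rintro ⟨F, e⟩ h
    simp only [mem_sigma, mem_powersetCard] at h ⊢
    refine ⟨h.1.1 h.2, Finset.erase_subset_erase _ h.1.1, ?_⟩
    rw [card_erase_of_mem h.2, h.1.2]; rfl
  · rintro ⟨e, F⟩ h
    simp only [mem_sigma, mem_powersetCard] at h ⊢
    have he : e ∉ F := fun h' => by simpa using h.2.1 h'
    refine ⟨⟨insert_subset h.1 (h.2.1.trans (erase_subset _ _)), ?_⟩, mem_insert_self _ _⟩
    rw [card_insert_of_notMem he, h.2.2]
  · rintro ⟨F, e⟩ h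
    simp only [mem_sigma, mem_powersetCard] at h
    simp [insert_erase h.2]
  · rintro ⟨e, F⟩ h
    simp only [mem_sigma, mem_powersetCard] at h
    have he : e ∉ F := fun h' => by simpa using h.2.1 h'
    simp [erase_insert he]
  · rintro ⟨F, e⟩ h
    simp only [mem_sigma, mem_powersetCard] at h
    simp [insert_erase h.2]

/-- The number of `t`-subsets of `U` containing a given set of size `s` is at most the fraction
`(t / #U) ^ s` of all `t`-subsets. -/
theorem card_superset_le {α : Type*} [DecidableEq α] (U S : Finset α) (t : ℕ) (ht : t ≤ #U) :
    (#{F ∈ U.powersetCard t | S ⊆ F} : ℝ) ≤ (#U).choose t * ((t : ℝ) / #U) ^ #S := by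
  induction S using Finset.induction_on generalizing U t with
  | empty => simp
  | insert a S ha ih =>
    by_cases haU : a ∈ U
    swap
    · have : {F ∈ U.powersetCard t | insert a S ⊆ F} = ∅ := by
        refine filter_eq_empty_iff.mpr fun F hF h => haU ?_
        exact (mem_powersetCard.mp hF).1 (h (mem_insert_self _ _))
      rw [this]; simp; positivity
    cases t with
    | zero =>
      have : {F ∈ U.powersetCard 0 | insert a S ⊆ F} = ∅ := by
        refine filter_eq_empty_iff.mpr fun F hF h => ?_
        have h0 : F = ∅ := by simpa using hF
        simpa [h0] using h (mem_insert_self _ _)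
      rw [this]; simp
    | succ t =>
      have hU : #(U.erase a) = #U - 1 := card_erase_of_mem haU
      have hpos : 0 < #U := card_pos.mpr ⟨a, haU⟩
      have hle : #{F ∈ U.powersetCard (t + 1) | insert a S ⊆ F}
          ≤ #{F ∈ (U.erase a).powersetCard t | S ⊆ F} := by
        refine Finset.card_le_card_of_injOn (fun F => F.erase a) ?_ ?_
        · intro F hF
          simp only [coe_filter, mem_powersetCard, Set.mem_ofPred_eq] at hF ⊢
          have haF : a ∈ F := hF.2 (mem_insert_self _ _)
          refine ⟨⟨erase_subset_erase _ hF.1.1, ?_⟩, fun x hx => ?_⟩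
          · rw [card_erase_of_mem haF, hF.1.2]; rfl
          · exact mem_erase.mpr ⟨fun h => ha (h ▸ hx), hF.2 (mem_insert_of_mem hx)⟩
        · intro F hF F' hF' h
          simp only [coe_filter, Set.mem_ofPred_eq] at hF hF'
          rw [← insert_erase (hF.2 (mem_insert_self a S)),
            ← insert_erase (hF'.2 (mem_insert_self a S))]
          simp only at h
          rw [h]
      have h1 := ih (U.erase a) t (by omega)
      have h2 : (#{F ∈ U.powersetCard (t + 1) | insert a S ⊆ F} : ℝ)
          ≤ (#(U.erase a)).choose t * ((t : ℝ) / #(U.erase a)) ^ #S :=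
        le_trans (by exact_mod_cast hle) h1
      refine h2.trans ?_
      rw [card_insert_of_notMem ha, pow_succ, hU]
      obtain ⟨u, hu⟩ : ∃ u, #U = u + 1 := ⟨#U - 1, by omega⟩
      rw [hu, Nat.add_sub_cancel]
      have hid : ((u + 1 : ℕ) : ℝ) * u.choose t = (u + 1).choose (t + 1) * ((t + 1 : ℕ) : ℝ) := by
        exact_mod_cast Nat.add_one_mul_choose_eq u t
      have hfrac : (t : ℝ) / u ≤ ((t + 1 : ℕ) : ℝ) / ((u + 1 : ℕ) : ℝ) := by
        rcases Nat.eq_zero_or_pos u with h0 | h0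
        · rw [h0]; simp; positivity
        · rw [div_le_div_iff₀ (by exact_mod_cast h0) (by positivity)]
          have : t ≤ u := by omega
          push_cast
          have : (t : ℝ) ≤ u := by exact_mod_cast this
          nlinarith
      have h3 : (u.choose t : ℝ) =
          (u + 1).choose (t + 1) * (((t + 1 : ℕ) : ℝ) / ((u + 1 : ℕ) : ℝ)) := by
        rw [← mul_div_assoc, ← hid]; field_simp
      calc (u.choose t : ℝ) * ((t : ℝ) / u) ^ #S
          ≤ u.choose t * (((t + 1 : ℕ) : ℝ) / ((u + 1 : ℕ) : ℝ)) ^ #S := by gcongr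
        _ = _ := by rw [h3]; ring

/-- The exponential moment of a hypergeometric variable is at most that of the binomial variable
with the same mean parameter, on both sides of `z = 1`: passing from `t` to `t + 1` chosen elements
multiplies by a factor that varies oppositely to `z ^ #(F ∩ A)`. -/
theorem sum_pow_card_inter_le {α : Type*} [DecidableEq α] (U A : Finset α) (hA : A ⊆ U) (z : ℝ)
    (hz : 0 < z) (t : ℕ) (ht : t ≤ #U) :
    ∑ F ∈ U.powersetCard t, z ^ #(F ∩ A) ≤
      (#U).choose t * (1 + (z - 1) * ((#A : ℝ) / #U)) ^ t := by
  induction t with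
  | zero => simp
  | succ t ih =>
    have hu0 : 0 < #U := by omega
    have hu : (0 : ℝ) < #U := by exact_mod_cast hu0
    have ih := ih (by omega)
    set w : α → ℝ := fun e => if e ∈ A then z else 1 with hw
    have hwsum : ∑ e ∈ U, w e = #U * (1 + (z - 1) * ((#A : ℝ) / #U)) := by
      have h1 : ∀ e ∈ U, w e = 1 + (z - 1) * (if e ∈ A then 1 else 0) := by
        intro e _; simp only [hw]; split_ifs <;> ring
      rw [sum_congr rfl h1, sum_add_distrib, ← mul_sum, sum_ite_mem, inter_eq_right.mpr hA]
      simp; field_simp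
    have hins : ∀ (F : Finset α) (e : α), e ∉ F → z ^ #(insert e F ∩ A) = w e * z ^ #(F ∩ A) := by
      intro F e he
      simp only [hw]
      by_cases h : e ∈ A
      · rw [insert_inter_of_mem h,
          card_insert_of_notMem (fun h' => he (mem_inter.mp h').1), if_pos h]
        ring
      · rw [insert_inter_of_notMem h, if_neg h, one_mul]
    have hrec : ((t + 1 : ℕ) : ℝ) * ∑ F ∈ U.powersetCard (t + 1), z ^ #(F ∩ A) =
        ∑ F ∈ U.powersetCard t, z ^ #(F ∩ A) * ∑ e ∈ U \ F, w e := by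
      have h1 := sum_powersetCard_succ U t (fun F _ => z ^ #(F ∩ A))
      have h2 : ∑ F ∈ U.powersetCard (t + 1), ∑ _e ∈ F, z ^ #(F ∩ A) =
          ((t + 1 : ℕ) : ℝ) * ∑ F ∈ U.powersetCard (t + 1), z ^ #(F ∩ A) := by
        rw [mul_sum]
        refine sum_congr rfl fun F hF => ?_
        rw [sum_const, (mem_powersetCard.mp hF).2, nsmul_eq_mul]
      rw [← h2, h1]
      simp_rw [mul_sum]
      rw [Finset.sum_comm' (t' := U.powersetCard t) (s' := fun F => U \ F)]
      · refine sum_congr rfl fun F _ => sum_congr rfl fun e he => ?_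
        rw [hins F e (Finset.mem_sdiff.mp he).2]; ring
      · intro e F
        simp only [mem_powersetCard, Finset.mem_sdiff, subset_erase]
        tauto
    have hmean : ∑ F ∈ U.powersetCard t, ∑ e ∈ U \ F, w e =
        (#U - 1).choose t * ∑ e ∈ U, w e := by
      rw [Finset.sum_comm' (t' := U) (s' := fun e => (U.erase e).powersetCard t)]
      · rw [mul_sum]
        refine sum_congr rfl fun e he => ?_
        rw [sum_const, card_powersetCard, card_erase_of_mem he, nsmul_eq_mul]
      · intro F e
        simp only [mem_powersetCard, Finset.mem_sdiff, subset_erase]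
        tauto
    have hfac : ∀ F ∈ U.powersetCard t,
        ∑ e ∈ U \ F, w e = ((#U : ℝ) - t) + (z - 1) * (#A - #(F ∩ A)) := by
      intro F hF
      obtain ⟨hF1, hF2⟩ := mem_powersetCard.mp hF
      have h1 : ∀ e ∈ U \ F, w e = 1 + (z - 1) * (if e ∈ A then 1 else 0) := by
        intro e _; simp only [hw]; split_ifs <;> ring
      rw [sum_congr rfl h1, sum_add_distrib, ← mul_sum, sum_ite_mem]
      have h2 : #((U \ F) ∩ A) + #(F ∩ A) = #A := by
        rw [← card_union_of_disjoint]
        · congr 1; ext x; simp only [mem_union, mem_inter, Finset.mem_sdiff]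
          have := @hA x; tauto
        · rw [Finset.disjoint_left]; intro x; simp; tauto
      have h3 : #(U \ F) + #F = #U := card_sdiff_add_card_eq_card hF1
      have h2' : (#((U \ F) ∩ A) : ℝ) = #A - #(F ∩ A) := by rw [← h2]; push_cast; ring
      have h3' : (#(U \ F) : ℝ) = #U - t := by rw [← h3, ← hF2]; push_cast; ring
      simp [h2', h3']
    -- Chebyshev's sum inequality applies, as the two factors vary oppositely
    have hanti : AntivaryOn (fun F : Finset α => z ^ #(F ∩ A)) (fun F => ∑ e ∈ U \ F, w e)
        (U.powersetCard t : Set (Finset α)) := by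
      intro F hF F' hF' h
      simp only at h ⊢
      rw [hfac F hF, hfac F' hF'] at h
      have h' : (z - 1) * ((#(F' ∩ A) : ℝ)) < (z - 1) * (#(F ∩ A) : ℝ) := by linarith
      rcases le_total 1 z with h1 | h1
      · have : (#(F' ∩ A) : ℝ) ≤ #(F ∩ A) := by
          by_contra hc; push Not at hc
          nlinarith
        exact pow_le_pow_right₀ h1 (by exact_mod_cast this)
      · have : (#(F ∩ A) : ℝ) ≤ #(F' ∩ A) := by
          by_contra hc; push Not at hc
          nlinarith
        exact pow_le_pow_of_le_one hz.le h1 (by exact_mod_cast this)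
    have hcheb := hanti.card_mul_sum_le_sum_mul_sum
    rw [card_powersetCard, ← hrec, hmean, hwsum] at hcheb
    set y := 1 + (z - 1) * ((#A : ℝ) / #U) with hy
    have hy0 : 0 ≤ y := by
      have h1 : (#A : ℝ) / #U ≤ 1 := by
        rw [div_le_one hu]; exact_mod_cast card_le_card hA
      have h2 : 0 ≤ (#A : ℝ) / #U := by positivity
      rw [hy]; nlinarith
    obtain ⟨u, hu'⟩ : ∃ u, #U = u + 1 := ⟨#U - 1, by omega⟩
    rw [hu', Nat.add_sub_cancel] at hcheb
    rw [hu'] at ih ⊢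
    have hcp : (0 : ℝ) < (u + 1).choose t := by exact_mod_cast Nat.choose_pos (by omega)
    have hid : ((u + 1 : ℕ) : ℝ) * u.choose t = (u + 1).choose (t + 1) * ((t + 1 : ℕ) : ℝ) := by
      exact_mod_cast Nat.add_one_mul_choose_eq u t
    set S := ∑ F ∈ U.powersetCard t, z ^ #(F ∩ A)
    set S' := ∑ F ∈ U.powersetCard (t + 1), z ^ #(F ∩ A)
    have h4 : ((u + 1).choose t : ℝ) * ((t + 1 : ℕ) : ℝ) * S' ≤
        (u + 1).choose t * ((t + 1 : ℕ) : ℝ) * ((u + 1).choose (t + 1) * y ^ (t + 1)) := by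
      calc ((u + 1).choose t : ℝ) * ((t + 1 : ℕ) : ℝ) * S'
          ≤ S * (u.choose t * (((u + 1 : ℕ) : ℝ) * y)) := by linarith [hcheb]
        _ = S * ((((u + 1 : ℕ) : ℝ) * u.choose t) * y) := by ring
        _ ≤ ((u + 1).choose t * y ^ t) * ((((u + 1 : ℕ) : ℝ) * u.choose t) * y) := by gcongr
        _ = _ := by rw [hid]; ring
    exact le_of_mul_le_mul_left h4 (by positivity)

/-- Markov's inequality for the lower tail of the hypergeometric distribution. -/
theorem card_inter_le_le {α : Type*} [DecidableEq α] (U A : Finset α) (hA : A ⊆ U) (z : ℝ)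
    (hz : 0 < z) (hz1 : z ≤ 1) (t j : ℕ) (ht : t ≤ #U) :
    (#{F ∈ U.powersetCard t | #(F ∩ A) ≤ j} : ℝ) ≤
      (#U).choose t * ((1 + (z - 1) * ((#A : ℝ) / #U)) ^ t * (z ^ j)⁻¹) := by
  have h := sum_pow_card_inter_le U A hA z hz t ht
  have h1 : (#{F ∈ U.powersetCard t | #(F ∩ A) ≤ j} : ℝ) * z ^ j
      ≤ ∑ F ∈ U.powersetCard t, z ^ #(F ∩ A) := by
    rw [← nsmul_eq_mul, ← sum_const]
    refine (sum_le_sum fun F hF => ?_).trans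
      (sum_le_sum_of_subset_of_nonneg (filter_subset _ _) fun F _ _ => by positivity)
    exact pow_le_pow_of_le_one hz.le hz1 (mem_filter.mp hF).2
  rw [← mul_assoc, ← div_eq_mul_inv, le_div_iff₀ (by positivity)]
  exact h1.trans h

/-- Markov's inequality for the upper tail of the hypergeometric distribution. -/
theorem card_le_inter_le {α : Type*} [DecidableEq α] (U A : Finset α) (hA : A ⊆ U) (z : ℝ)
    (hz : 1 ≤ z) (t j : ℕ) (ht : t ≤ #U) :
    (#{F ∈ U.powersetCard t | j ≤ #(F ∩ A)} : ℝ) ≤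
      (#U).choose t * ((1 + (z - 1) * ((#A : ℝ) / #U)) ^ t * (z ^ j)⁻¹) := by
  have hz0 : 0 < z := by linarith
  have h := sum_pow_card_inter_le U A hA z hz0 t ht
  have h1 : (#{F ∈ U.powersetCard t | j ≤ #(F ∩ A)} : ℝ) * z ^ j
      ≤ ∑ F ∈ U.powersetCard t, z ^ #(F ∩ A) := by
    rw [← nsmul_eq_mul, ← sum_const]
    refine (sum_le_sum fun F hF => ?_).trans
      (sum_le_sum_of_subset_of_nonneg (filter_subset _ _) fun F _ _ => by positivity)
    exact pow_le_pow_right₀ hz (mem_filter.mp hF).2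
  rw [← mul_assoc, ← div_eq_mul_inv, le_div_iff₀ (by positivity)]
  exact h1.trans h

/-- The sprinkling estimate. Let `A d R` express that the configuration `R` is within distance `d`
of the target. If, whenever the distance cannot be lowered for free, at least a fraction `β` of the
ground set consists of elements whose addition lowers it, then a random `t`-set fails to reach the
target from distance `d` with probability at most `(1 - β / 2) ^ t * 2 ^ d`. -/
theorem card_fail_le {α : Type*} [DecidableEq α] (U : Finset α) (A : ℕ → Finset α → Prop)
    [∀ d R, Decidable (A d R)]
    (mono : ∀ d R R', R ⊆ R' → A d R → A d R') (β : ℝ) (h0 : 0 ≤ β) (h1 : β ≤ 1)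
    (step : ∀ d R, R ⊆ U → A (d + 1) R →
      A d R ∨ β * #U ≤ #{e ∈ U \ R | A d (insert e R)}) :
    ∀ t d R, R ⊆ U → A d R →
      (#{F ∈ (U \ R).powersetCard t | ¬ A 0 (R ∪ F)} : ℝ) ≤
        (#(U \ R)).choose t * ((1 - β / 2) ^ t * 2 ^ d) := by
  have hρ : 0 ≤ 1 - β / 2 := by linarith
  intro t
  induction t with
  | zero =>
    intro d R _ _
    refine le_trans (b := (1 : ℝ)) ?_ ?_
    · have : #{F ∈ (U \ R).powersetCard 0 | ¬ A 0 (R ∪ F)} ≤ 1 :=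
        (card_filter_le _ _).trans (by simp)
      exact_mod_cast this
    · simpa using one_le_pow₀ (by norm_num : (1 : ℝ) ≤ 2)
  | succ t ih =>
    intro d
    induction d with
    | zero =>
      intro R _ hA
      have : {F ∈ (U \ R).powersetCard (t + 1) | ¬ A 0 (R ∪ F)} = ∅ :=
        filter_eq_empty_iff.mpr fun F _ h => h (mono 0 R _ subset_union_left hA)
      rw [this]; simp only [card_empty, Nat.cast_zero]; positivity
    | succ d ihd =>
      intro R hR hA
      rcases step d R hR hA with hd | hd
      · refine (ihd R hR hd).trans ?_
        gcongr
        · norm_num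
        · omega
      set Q := U \ R with hQ
      have hQU : (#Q : ℝ) ≤ #U := by exact_mod_cast card_le_card sdiff_subset
      set B := {e ∈ Q | A d (insert e R)} with hB
      have hBQ : B ⊆ Q := filter_subset _ _
      have hdiff : ∀ e ∈ Q, U \ insert e R = Q.erase e := by
        intro e _; ext x; simp only [hQ, Finset.mem_sdiff, mem_insert, mem_erase]; tauto
      have hsub : ∀ e ∈ Q, insert e R ⊆ U := fun e he =>
        insert_subset (Finset.mem_sdiff.mp he).1 hR
      have hun : ∀ (e : α) (F : Finset α), insert e R ∪ F = R ∪ insert e F := by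
        intro e F; ext x; simp
      set M : ℝ := (#Q - 1).choose t * (1 - β / 2) ^ t with hM
      have hM0 : 0 ≤ M := by positivity
      have hterm : ∀ e ∈ Q, (#{F ∈ (Q.erase e).powersetCard t | ¬ A 0 (R ∪ insert e F)} : ℝ)
          ≤ M * (if e ∈ B then 2 ^ d else 2 ^ (d + 1)) := by
        intro e he
        have hce : #(Q.erase e) = #Q - 1 := card_erase_of_mem he
        split_ifs with heB
        · have := ih d (insert e R) (hsub e he) (mem_filter.mp heB).2
          simp only [hdiff e he, hun, hce] at this
          rw [hM, mul_assoc]; exact this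
        · have := ih (d + 1) (insert e R) (hsub e he) (mono _ R _ (subset_insert _ _) hA)
          simp only [hdiff e he, hun, hce] at this
          rw [hM, mul_assoc]; exact this
      have hcount : ((t + 1 : ℕ) : ℝ) * #{F ∈ Q.powersetCard (t + 1) | ¬ A 0 (R ∪ F)}
          = ∑ e ∈ Q, (#{F ∈ (Q.erase e).powersetCard t | ¬ A 0 (R ∪ insert e F)} : ℝ) := by
        have h2 := sum_powersetCard_succ Q t
          (fun F _ => if ¬ A 0 (R ∪ F) then (1 : ℝ) else 0)
        simp only [sum_boole] at h2
        rw [← h2]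
        rw [card_filter, Nat.cast_sum, mul_sum]
        refine sum_congr rfl fun F hF => ?_
        rw [filter_const]
        split_ifs
        · simp
        · simp [(mem_powersetCard.mp hF).2]
      have hsum : ∑ e ∈ Q, M * (if e ∈ B then (2 : ℝ) ^ d else 2 ^ (d + 1)) =
          M * 2 ^ (d + 1) * (#Q - #B / 2) := by
        have : ∀ e ∈ Q, M * (if e ∈ B then (2 : ℝ) ^ d else 2 ^ (d + 1)) =
            M * 2 ^ (d + 1) * (1 - (if e ∈ B then 1 else 0) / 2) := by
          intro e _; split_ifs <;> ring
        rw [sum_congr rfl this, ← mul_sum, sum_sub_distrib, ← sum_div, sum_ite_mem,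
          inter_eq_right.mpr hBQ]
        simp
      have hmain : ((t + 1 : ℕ) : ℝ) * #{F ∈ Q.powersetCard (t + 1) | ¬ A 0 (R ∪ F)} ≤
          M * 2 ^ (d + 1) * (#Q * (1 - β / 2)) := by
        rw [hcount]
        refine (sum_le_sum hterm).trans ?_
        rw [hsum]
        gcongr
        nlinarith
      rcases Nat.eq_zero_or_pos #Q with hq0 | hq0
      · rw [hq0] at hmain
        simp only [Nat.cast_zero, zero_mul, mul_zero] at hmain
        have : (#{F ∈ Q.powersetCard (t + 1) | ¬ A 0 (R ∪ F)} : ℝ) ≤ 0 := by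
          by_contra hc; push Not at hc
          have : 0 < ((t + 1 : ℕ) : ℝ) * #{F ∈ Q.powersetCard (t + 1) | ¬ A 0 (R ∪ F)} := by
            positivity
          linarith
        exact this.trans (by positivity)
      · obtain ⟨u, hu⟩ : ∃ u, #Q = u + 1 := ⟨#Q - 1, by omega⟩
        have hid : ((u + 1 : ℕ) : ℝ) * u.choose t = (u + 1).choose (t + 1) * ((t + 1 : ℕ) : ℝ) := by
          exact_mod_cast Nat.add_one_mul_choose_eq u t
        refine le_of_mul_le_mul_left (hmain.trans (le_of_eq ?_))
          (by positivity : (0 : ℝ) < ((t + 1 : ℕ) : ℝ))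
        rw [hM, hu, Nat.add_sub_cancel]
        calc _ = (((u + 1 : ℕ) : ℝ) * u.choose t) * (1 - β / 2) ^ (t + 1) * 2 ^ (d + 1) := by ring
          _ = _ := by rw [hid]; ring

/-- If, after fixing the part of a random `t`-set inside `A`, a property has conditional
probability at most `η`, then it has probability at most `η`. -/
theorem card_filter_le_of_fiber {α : Type*} [DecidableEq α] (U A : Finset α) (t : ℕ)
    (p : Finset α → Prop) [DecidablePred p] (η : ℝ)
    (h : ∀ F₁ ⊆ U ∩ A, #F₁ ≤ t →
      (#{F₂ ∈ (U \ A).powersetCard (t - #F₁) | p (F₁ ∪ F₂)} : ℝ) ≤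
        η * (#(U \ A)).choose (t - #F₁)) :
    (#{F ∈ U.powersetCard t | p F} : ℝ) ≤ η * (#U).choose t := by
  have key : ∀ (q : Finset α → Prop) [DecidablePred q], ∀ F₁ ⊆ U ∩ A, #F₁ ≤ t →
      #{F ∈ U.powersetCard t | q F ∧ F ∩ A = F₁} =
        #{F₂ ∈ (U \ A).powersetCard (t - #F₁) | q (F₁ ∪ F₂)} := by
    intro q _ F₁ hF₁ ht
    refine Finset.card_bij' (fun F _ => F \ A) (fun F₂ _ => F₁ ∪ F₂) ?_ ?_ ?_ ?_
    · intro F hF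
      simp only [mem_filter, mem_powersetCard] at hF ⊢
      obtain ⟨⟨h1, h2⟩, h3, h4⟩ := hF
      refine ⟨⟨sdiff_subset_sdiff h1 le_rfl, ?_⟩, ?_⟩
      · have := card_inter_add_card_sdiff F A
        rw [h4] at this; omega
      · rw [← h4, union_comm, sdiff_union_inter]; exact h3
    · intro F₂ hF
      simp only [mem_filter, mem_powersetCard] at hF ⊢
      obtain ⟨⟨h1, h2⟩, h3⟩ := hF
      have hd : Disjoint F₁ F₂ := by
        rw [Finset.disjoint_left]; intro x hx hx'
        exact (Finset.mem_sdiff.mp (h1 hx')).2 (mem_inter.mp (hF₁ hx)).2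
      refine ⟨⟨union_subset (hF₁.trans inter_subset_left) (h1.trans sdiff_subset), ?_⟩, h3, ?_⟩
      · rw [card_union_of_disjoint hd]; omega
      · ext x
        have := @h1 x; have := @hF₁ x
        simp only [mem_inter, mem_union, Finset.mem_sdiff] at *
        tauto
    · intro F hF
      simp only [mem_filter] at hF
      rw [← hF.2.2, union_comm, sdiff_union_inter]
    · intro F₂ hF
      simp only [mem_filter, mem_powersetCard] at hF
      ext x
      have := @hF.1.1 x; have := @hF₁ x
      simp only [mem_inter, mem_union, Finset.mem_sdiff] at *
      tauto
  have hsplit : ∀ (q : Finset α → Prop) [DecidablePred q],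
      (#{F ∈ U.powersetCard t | q F} : ℝ) = ∑ F₁ ∈ {F₁ ∈ (U ∩ A).powerset | #F₁ ≤ t},
        (#{F₂ ∈ (U \ A).powersetCard (t - #F₁) | q (F₁ ∪ F₂)} : ℝ) := by
    intro q _
    rw [Finset.card_eq_sum_card_fiberwise (f := fun F => F ∩ A)
      (t := {F₁ ∈ (U ∩ A).powerset | #F₁ ≤ t}), Nat.cast_sum]
    · refine sum_congr rfl fun F₁ hF₁ => ?_
      simp only [mem_filter, mem_powerset] at hF₁
      rw [← key q F₁ hF₁.1 hF₁.2, filter_filter]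
    · intro F hF
      simp only [coe_filter, mem_powersetCard, Set.mem_ofPred_eq, mem_powerset] at hF ⊢
      exact ⟨inter_subset_inter_right hF.1.1, (card_le_card inter_subset_left).trans hF.1.2.le⟩
  rw [hsplit p]
  have htot := hsplit (fun _ => True)
  simp only [filter_true, card_powersetCard] at htot
  rw [htot, mul_sum]
  refine sum_le_sum fun F₁ hF₁ => ?_
  simp only [mem_filter, mem_powerset] at hF₁
  exact h F₁ hF₁.1 hF₁.2

/-! ### Paths, rotations and boosters -/

section Paths

variable {V : Type*}

/-- The first `p` values of `f` form a path in the vertex set `X` with all edges in `E`. Paths are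
encoded by functions on `ℕ`, of which only the values below `p` matter. -/
structure IsPathIn (E : Set (Sym2 V)) (X : Finset V) (f : ℕ → V) (p : ℕ) : Prop where
  inj : ∀ i < p, ∀ j < p, f i = f j → i = j
  mem : ∀ i < p, f i ∈ X
  adj : ∀ i, i + 1 < p → s(f i, f (i + 1)) ∈ E

theorem IsPathIn.mono {E E' : Set (Sym2 V)} {X : Finset V} {f : ℕ → V} {p : ℕ}
    (h : IsPathIn E X f p) (hE : E ⊆ E') : IsPathIn E' X f p :=
  ⟨h.inj, h.mem, fun i hi => hE (h.adj i hi)⟩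

theorem IsPathIn.card_le {E : Set (Sym2 V)} {X : Finset V} {f : ℕ → V} {p : ℕ}
    (h : IsPathIn E X f p) : p ≤ #X := by
  have := Finset.card_le_card_of_injOn (s := range p) (t := X) f
    (fun i hi => h.mem i (by simpa using hi))
    (fun i hi j hj hij => h.inj i (by simpa using hi) j (by simpa using hj) hij)
  simpa using this

/-- The path `f` read backwards. -/
theorem IsPathIn.reverse {E : Set (Sym2 V)} {X : Finset V} {f : ℕ → V} {p : ℕ}
    (h : IsPathIn E X f p) : IsPathIn E X (fun i => f (p - 1 - i)) p := by
  refine ⟨fun i hi j hj hij => ?_, fun i hi => h.mem _ (by omega), fun i hi => ?_⟩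
  · have := h.inj _ (by omega) _ (by omega) hij
    omega
  · have := h.adj (p - 1 - (i + 1)) (by omega)
    rw [show p - 1 - (i + 1) + 1 = p - 1 - i by omega, Sym2.eq_swap] at this
    exact this

/-- The Pósa rotation of a path with `p` vertices that uses the edge from its last vertex to
vertex number `i`: the part of the path after that vertex is reversed. -/
def rotation (p : ℕ) (f : ℕ → V) (i j : ℕ) : V :=
  if j ≤ i then f j else f (p + i - j)

theorem IsPathIn.rotation {E : Set (Sym2 V)} {X : Finset V} {f : ℕ → V} {p : ℕ}
    (h : IsPathIn E X f p) {i : ℕ} (hi : i + 1 < p) (he : s(f (p - 1), f i) ∈ E) :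
    IsPathIn E X (rotation p f i) p := by
  refine ⟨fun a ha b hb hab => ?_, fun a ha => ?_, fun a ha => ?_⟩
  · unfold CorePacking.rotation at hab
    split_ifs at hab with h1 h2 h2
    · exact h.inj _ ha _ hb hab
    · have := h.inj _ ha _ (by omega) hab; omega
    · have := h.inj _ (by omega) _ hb hab; omega
    · have := h.inj _ (by omega) _ (by omega) hab; omega
  · unfold CorePacking.rotation
    split_ifs
    · exact h.mem _ ha
    · exact h.mem _ (by omega)
  · unfold CorePacking.rotation
    rcases lt_trichotomy a i with h1 | h1 | h1
    · rw [if_pos (by omega), if_pos (by omega)]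
      exact h.adj a ha
    · subst h1
      rw [if_pos le_rfl, if_neg (by omega), show p + a - (a + 1) = p - 1 by omega, Sym2.eq_swap]
      exact he
    · rw [if_neg (by omega), if_neg (by omega)]
      have := h.adj (p + i - (a + 1)) (by omega)
      rw [show p + i - (a + 1) + 1 = p + i - a by omega, Sym2.eq_swap] at this
      exact this

/-- `RotReach E p f g`: the path `g` arises from the path `f` on `p` vertices by Pósa rotations
along edges in `E`, all keeping the first vertex. -/
inductive RotReach (E : Set (Sym2 V)) (p : ℕ) (f : ℕ → V) : (ℕ → V) → Prop
  | refl : RotReach E p f f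
  | step (g : ℕ → V) (i : ℕ) : RotReach E p f g → i + 1 < p → s(g (p - 1), g i) ∈ E →
      RotReach E p f (rotation p g i)

/-- `x` and `y` are consecutive, in either order, on the path given by the first `p` values
of `f`. -/
def Consecutive (p : ℕ) (f : ℕ → V) (x y : V) : Prop :=
  ∃ j, j + 1 < p ∧ ((f j = x ∧ f (j + 1) = y) ∨ (f j = y ∧ f (j + 1) = x))

theorem RotReach.isPathIn {E : Set (Sym2 V)} {X : Finset V} {f g : ℕ → V} {p : ℕ}
    (hg : RotReach E p f g) (h : IsPathIn E X f p) : IsPathIn E X g p := by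
  induction hg with
  | refl => exact h
  | step g i _ hi he ih => exact ih.rotation hi he

theorem RotReach.zero {E : Set (Sym2 V)} {f g : ℕ → V} {p : ℕ}
    (hg : RotReach E p f g) : g 0 = f 0 := by
  induction hg with
  | refl => rfl
  | step g i _ hi he ih => simpa [rotation] using ih

theorem RotReach.exists_eq {E : Set (Sym2 V)} {f g : ℕ → V} {p : ℕ}
    (hg : RotReach E p f g) : ∀ i < p, ∃ j < p, g i = f j := by
  induction hg with
  | refl => exact fun i hi => ⟨i, hi, rfl⟩
  | step g i _ hi he ih =>
    intro a ha
    unfold rotation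
    split_ifs
    · exact ih a ha
    · exact ih _ (by omega)

/-- A rotation destroys only the edge between vertex number `i` and its successor, and the
successor becomes the new last vertex. Hence the neighbours on `f` of a vertex `w` survive all
rotations, as long as neither `w` nor any of these neighbours ever becomes a last vertex. -/
theorem RotReach.consecutive {E : Set (Sym2 V)} {f g : ℕ → V} {p : ℕ}
    (hg : RotReach E p f g) {w : V} (hw : ∀ g', RotReach E p f g' → g' (p - 1) ≠ w)
    (hnb : ∀ x, Consecutive p f w x → ∀ g', RotReach E p f g' → g' (p - 1) ≠ x) :
    ∀ x, Consecutive p f w x → Consecutive p g w x := by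
  induction hg with
  | refl => exact fun x hx => hx
  | step g i hg' hi he ih =>
    intro x hx
    obtain ⟨j, hj, hc⟩ := ih x hx
    have hlast : rotation p g i (p - 1) = g (i + 1) := by
      unfold rotation
      rw [if_neg (by omega), show p + i - (p - 1) = i + 1 by omega]
    have hstep := RotReach.step g i hg' hi he
    rcases lt_trichotomy j i with h1 | h1 | h1
    · refine ⟨j, hj, ?_⟩
      unfold rotation
      rw [if_pos (by omega), if_pos (by omega)]
      exact hc
    · subst h1
      rcases hc with ⟨_, h3⟩ | ⟨_, h3⟩
      · exact absurd (hlast.trans h3) (hnb x hx _ hstep)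
      · exact absurd (hlast.trans h3) (hw _ hstep)
    · refine ⟨p + i - (j + 1), by omega, ?_⟩
      unfold rotation
      rw [if_neg (by omega), if_neg (by omega),
        show p + i - (p + i - (j + 1)) = j + 1 by omega,
        show p + i - (p + i - (j + 1) + 1) = j by omega]
      tauto

open Classical in
/-- The set of vertices of `X` outside `S` that are joined to `S` by an edge in `E`. -/
noncomputable def outerNeighbors (E : Set (Sym2 V)) (X S : Finset V) : Finset V :=
  {w ∈ X | w ∉ S ∧ ∃ u ∈ S, s(u, w) ∈ E}

theorem mem_outerNeighbors {E : Set (Sym2 V)} {X S : Finset V} {w : V} :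
    w ∈ outerNeighbors E X S ↔ w ∈ X ∧ w ∉ S ∧ ∃ u ∈ S, s(u, w) ∈ E := by
  classical
  exact mem_filter

/-- Pósa's rotation lemma: the set `S` of last vertices of paths obtained by rotating a longest
path has fewer than `2 * #S` outer neighbours, because each of them is next to a member of `S` on
the original path. -/
theorem exists_endpoints {E : Set (Sym2 V)} {X : Finset V} {f : ℕ → V} {p : ℕ}
    (h : IsPathIn E X f p) (hp : 1 ≤ p) (hmax : ∀ g, ¬ IsPathIn E X g (p + 1)) :
    ∃ S ⊆ X, S.Nonempty ∧ #(outerNeighbors E X S) < 2 * #S ∧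
      ∀ u ∈ S, ∃ g, IsPathIn E X g p ∧ g 0 = f 0 ∧ g (p - 1) = u := by
  classical
  set S : Finset V := {u ∈ X | ∃ g, RotReach E p f g ∧ g (p - 1) = u} with hS
  have hmemS : ∀ g, RotReach E p f g → g (p - 1) ∈ S := fun g hg =>
    mem_filter.mpr ⟨(hg.isPathIn h).mem _ (by omega), g, hg, rfl⟩
  refine ⟨S, filter_subset _ _, ⟨_, hmemS f .refl⟩, ?_, fun u hu => ?_⟩
  swap
  · obtain ⟨g, hg, hgu⟩ := (mem_filter.mp hu).2
    exact ⟨g, hg.isPathIn h, hg.zero, hgu⟩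
  have key : ∀ w ∈ outerNeighbors E X S, ∃ x ∈ S, Consecutive p f w x := by
    intro w hw
    obtain ⟨hwX, hwS, u, hu, huw⟩ := mem_outerNeighbors.mp hw
    obtain ⟨huX, g, hg, rfl⟩ := mem_filter.mp hu
    have hgp := hg.isPathIn h
    by_contra hcon
    push Not at hcon
    have hcons := hg.consecutive (w := w) (fun g' hg' he => hwS (he ▸ hmemS g' hg'))
      (fun x hx g' hg' he => hcon x (he ▸ hmemS g' hg') hx)
    -- `w` lies on `g`, as otherwise `g` could be extended by `w`
    have hon : ∃ j < p, g j = w := by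
      by_contra hno
      push Not at hno
      refine hmax (fun j => if j < p then g j else w) ⟨fun a ha b hb hab => ?_, fun a ha => ?_,
        fun a ha => ?_⟩
      · split_ifs at hab with h1 h2 h2
        · exact hgp.inj _ h1 _ h2 hab
        · exact absurd hab (hno a h1)
        · exact absurd hab.symm (hno b h2)
        · omega
      · split_ifs with h1
        · exact hgp.mem _ h1
        · exact hwX
      · rw [if_pos (by omega)]
        split_ifs with h1
        · exact hgp.adj _ h1
        · rw [show a = p - 1 by omega]; exact huw
    obtain ⟨j, hj, rfl⟩ := hon
    have hjp : j ≠ p - 1 := fun he => hwS (he ▸ hmemS g hg)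
    have hx : g (j + 1) ∈ S := by
      have := hmemS _ (RotReach.step g j hg (by omega) huw)
      unfold rotation at this
      rwa [if_neg (by omega), show p + j - (p - 1) = j + 1 by omega] at this
    have hnc := hcon _ hx
    obtain ⟨j', hj', hjj'⟩ := hg.exists_eq j hj
    have hj'p : j' ≠ p - 1 := fun he => hwS (by rw [hjj', he]; exact hmemS f .refl)
    -- the neighbours on `f` of `w` are neighbours on `g`, and there differ from `g (j + 1)`
    have hpred : ∀ x, Consecutive p f (g j) x → 1 ≤ j ∧ x = g (j - 1) := by
      intro x hx'
      obtain ⟨l, hl, hc⟩ := hcons x hx'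
      rcases hc with ⟨h3, h4⟩ | ⟨h3, h4⟩
      · have := hgp.inj _ (by omega) _ hj h3
        subst this
        exact absurd (h4 ▸ hx') hnc
      · have := hgp.inj _ (by omega) _ hj h4
        subst this
        exact ⟨by omega, by simpa using h3.symm⟩
    have hsucc := hpred (f (j' + 1)) ⟨j', by omega, Or.inl ⟨hjj'.symm, rfl⟩⟩
    rcases Nat.eq_zero_or_pos j' with h0 | h0
    · subst h0
      have : j = 0 := hgp.inj _ hj _ (by omega) (by rw [hg.zero, hjj'])
      omega
    · have hprev := hpred (f (j' - 1)) ⟨j' - 1, by omega, Or.inr ⟨rfl, by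
        rw [show j' - 1 + 1 = j' by omega, hjj']⟩⟩
      have := h.inj _ (by omega) _ (by omega) (hsucc.2.trans hprev.2.symm)
      omega
  set J : Finset ℕ := {j ∈ range p | f j ∈ S} with hJ
  have hSJ : S ⊆ J.image f := by
    intro u hu
    obtain ⟨_, g, hg, rfl⟩ := mem_filter.mp hu
    obtain ⟨j, hj, hgj⟩ := hg.exists_eq (p - 1) (by omega)
    exact mem_image.mpr ⟨j, mem_filter.mpr ⟨mem_range.mpr hj, hgj ▸ hu⟩, hgj.symm⟩
  have hJS : #J ≤ #S := by
    refine Finset.card_le_card_of_injOn f (fun j hj => (mem_filter.mp hj).2) ?_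
    intro a ha b hb hab
    exact h.inj _ (mem_range.mp (mem_filter.mp ha).1) _ (mem_range.mp (mem_filter.mp hb).1) hab
  have hlast : p - 1 ∈ J := mem_filter.mpr ⟨mem_range.mpr (by omega), hmemS f .refl⟩
  have hNJ : outerNeighbors E X S ⊆
      ((J.erase (p - 1)).image (· + 1)).image f ∪ (J.image (· - 1)).image f := by
    intro w hw
    obtain ⟨x, hx, j, hj, hc⟩ := key w hw
    rcases hc with ⟨h3, h4⟩ | ⟨h3, h4⟩
    · refine mem_union_right _ (mem_image.mpr ⟨j, mem_image.mpr ⟨j + 1, mem_filter.mpr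
        ⟨mem_range.mpr hj, h4 ▸ hx⟩, by simp⟩, h3⟩)
    · refine mem_union_left _ (mem_image.mpr ⟨j + 1, mem_image.mpr ⟨j, mem_erase.mpr
        ⟨by omega, mem_filter.mpr ⟨mem_range.mpr (by omega), h3 ▸ hx⟩⟩, rfl⟩, h4⟩)
  have h1 := (card_le_card hNJ).trans (card_union_le _ _)
  have h2 : #(((J.erase (p - 1)).image (· + 1)).image f) ≤ #J - 1 :=
    (card_image_le.trans card_image_le).trans (card_erase_of_mem hlast).le
  have h3 : #((J.image (· - 1)).image f) ≤ #J := card_image_le.trans card_image_le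
  have h4 : 0 < #J := card_pos.mpr ⟨_, hlast⟩
  omega

/-- In an expander, a longest path can be replaced by paths of the same length with many different
pairs of end vertices. -/
theorem exists_endpoint_pairs {E : Set (Sym2 V)} {X : Finset V} {f : ℕ → V} {p s : ℕ}
    (h : IsPathIn E X f p) (hp : 1 ≤ p) (hmax : ∀ g, ¬ IsPathIn E X g (p + 1))
    (hexp : ∀ S ⊆ X, S.Nonempty → #(outerNeighbors E X S) < 2 * #S → s < #S) :
    ∃ A ⊆ X, s < #A ∧ ∀ a ∈ A, ∃ T ⊆ X, s < #T ∧
      ∀ b ∈ T, ∃ g, IsPathIn E X g p ∧ g 0 = a ∧ g (p - 1) = b := by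
  obtain ⟨A, hAX, hA0, hA1, hA2⟩ := exists_endpoints h hp hmax
  refine ⟨A, hAX, hexp A hAX hA0 hA1, fun a ha => ?_⟩
  obtain ⟨g, hg, -, hga⟩ := hA2 a ha
  obtain ⟨T, hTX, hT0, hT1, hT2⟩ := exists_endpoints hg.reverse hp hmax
  refine ⟨T, hTX, hexp T hTX hT0 hT1, fun b hb => ?_⟩
  obtain ⟨g', hg', hg'0, hg'b⟩ := hT2 b hb
  exact ⟨g', hg', by rw [hg'0]; simpa using hga, hg'b⟩

/-- A cycle missing few vertices of an expander can be opened to a path with one more vertex. -/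
theorem exists_longer_path {E E' : Set (Sym2 V)} {X : Finset V} {g : ℕ → V} {p s : ℕ}
    (h : IsPathIn E X g p) (hp : 1 ≤ p) (hEE' : E ⊆ E') (hc : s(g 0, g (p - 1)) ∈ E')
    (hpX : p < #X) (hs : #X ≤ p + s)
    (hexp : ∀ S ⊆ X, S.Nonempty → #(outerNeighbors E X S) < 2 * #S → s < #S) :
    ∃ g', IsPathIn E' X g' (p + 1) := by
  classical
  set I := (range p).image g with hI
  have hIcard : #I = p := by
    rw [hI, card_image_of_injOn, card_range]
    intro a ha b hb hab
    exact h.inj a (by simpa using ha) b (by simpa using hb) hab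
  have hIX : I ⊆ X := by
    intro x hx
    obtain ⟨j, hj, rfl⟩ := mem_image.mp hx
    exact h.mem j (mem_range.mp hj)
  have hY := card_sdiff_add_card_eq_card hIX
  have hY0 : (X \ I).Nonempty := card_pos.mp (by omega)
  have hN : (outerNeighbors E X (X \ I)).Nonempty := by
    by_contra hno
    rw [not_nonempty_iff_eq_empty] at hno
    have := hexp (X \ I) sdiff_subset hY0 (by rw [hno]; simpa using hY0)
    omega
  obtain ⟨w, hw⟩ := hN
  obtain ⟨hwX, hwY, y, hy, hyw⟩ := mem_outerNeighbors.mp hw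
  have hwI : w ∈ I := by
    by_contra hc'; exact hwY (Finset.mem_sdiff.mpr ⟨hwX, hc'⟩)
  obtain ⟨i, hi, rfl⟩ := mem_image.mp hwI
  rw [mem_range] at hi
  have hyI : ∀ j < p, g j ≠ y := fun j hj he =>
    (Finset.mem_sdiff.mp hy).2 (mem_image.mpr ⟨j, mem_range.mpr hj, he⟩)
  -- start at the outside vertex, then run once around the cycle
  set idx : ℕ → ℕ := fun j => if i + j - 1 < p then i + j - 1 else i + j - 1 - p with hidx
  have hlt : ∀ j, 1 ≤ j → j ≤ p → idx j < p := by
    intro j h1 h2; simp only [hidx]; split_ifs <;> omega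
  refine ⟨fun j => if j = 0 then y else g (idx j), fun a ha b hb hab => ?_, fun a ha => ?_,
    fun a ha => ?_⟩
  · split_ifs at hab with h1 h2 h2
    · omega
    · exact absurd hab.symm (hyI _ (hlt b (by omega) (by omega)))
    · exact absurd hab (hyI _ (hlt a (by omega) (by omega)))
    · have := h.inj _ (hlt a (by omega) (by omega)) _ (hlt b (by omega) (by omega)) hab
      simp only [hidx] at this
      split_ifs at this <;> omega
  · split_ifs with h1
    · exact (Finset.mem_sdiff.mp hy).1
    · exact h.mem _ (hlt a (by omega) (by omega))
  · simp only [Nat.add_eq_zero_iff, one_ne_zero, and_false, if_false]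
    split_ifs with h1
    · subst h1
      have : idx (0 + 1) = i := by simp [hidx, hi]
      rw [this]; exact hEE' hyw
    · simp only [hidx]
      by_cases h2 : i + a < p
      · rw [if_pos (by omega), if_pos (by omega)]
        have := h.adj (i + a - 1) (by omega)
        rw [show i + a - 1 + 1 = i + (a + 1) - 1 by omega] at this
        exact hEE' this
      · by_cases h3 : i + a = p
        · rw [if_pos (by omega), if_neg (by omega), show i + (a + 1) - 1 - p = 0 by omega,
            show i + a - 1 = p - 1 by omega, Sym2.eq_swap]
          exact hc
        · rw [if_neg (by omega), if_neg (by omega)]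
          have := h.adj (i + a - 1 - p) (by omega)
          rw [show i + a - 1 - p + 1 = i + (a + 1) - 1 - p by omega] at this
          exact hEE' this

end Paths

/-! ### Partial packings and their improvement -/

section Packings

variable {V : Type*}

/-- The edges of the path given by the first `p` values of `f`, together with the edge between its
end vertices if `b` is true. -/
def trackEdges (f : ℕ → V) (p : ℕ) (b : Bool) : Set (Sym2 V) :=
  {e | (∃ j, j + 1 < p ∧ e = s(f j, f (j + 1))) ∨ (b = true ∧ e = s(f 0, f (p - 1)))}

/-- A track is either a path in `X` with at least `w` vertices (for `b` false) or a Hamilton cycle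
of `X` (for `b` true), with edges in `E`. -/
structure IsTrack (E : Set (Sym2 V)) (X : Finset V) (w : ℕ) (f : ℕ → V) (p : ℕ) (b : Bool) :
    Prop where
  path : IsPathIn E X f p
  le : w ≤ p
  closed : b = true → p = #X ∧ s(f 0, f (p - 1)) ∈ E

/-- There are `r` edge-disjoint tracks whose scores, that is numbers of vertices plus one for each
closed track, have a sum at most `d` below the largest conceivable value `r * (#X + 1)`. -/
def HasTracks (E : Set (Sym2 V)) (X : Finset V) (w r d : ℕ) : Prop :=
  ∃ (f : Fin r → ℕ → V) (p : Fin r → ℕ) (b : Fin r → Bool),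
    (∀ i, IsTrack E X w (f i) (p i) (b i)) ∧
    (Pairwise fun i j => Disjoint (trackEdges (f i) (p i) (b i)) (trackEdges (f j) (p j) (b j))) ∧
    r * (#X + 1) ≤ d + ∑ i, (p i + (b i).toNat)

theorem IsTrack.mono {E E' : Set (Sym2 V)} {X : Finset V} {w : ℕ} {f : ℕ → V} {p : ℕ} {b : Bool}
    (h : IsTrack E X w f p b) (hE : E ⊆ E') : IsTrack E' X w f p b :=
  ⟨h.path.mono hE, h.le, fun hb => ⟨(h.closed hb).1, hE (h.closed hb).2⟩⟩

theorem HasTracks.mono {E E' : Set (Sym2 V)} {X : Finset V} {w r d : ℕ}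
    (h : HasTracks E X w r d) (hE : E ⊆ E') : HasTracks E' X w r d := by
  obtain ⟨f, p, b, h1, h2, h3⟩ := h
  exact ⟨f, p, b, fun i => (h1 i).mono hE, h2, h3⟩

theorem IsTrack.trackEdges_subset {E : Set (Sym2 V)} {X : Finset V} {w : ℕ} {f : ℕ → V} {p : ℕ}
    {b : Bool} (h : IsTrack E X w f p b) : trackEdges f p b ⊆ E := by
  rintro e (⟨j, hj, rfl⟩ | ⟨hb, rfl⟩)
  · exact h.path.adj j hj
  · exact (h.closed hb).2

open Classical in
theorem card_trackEdges_nbrs_le {E : Set (Sym2 V)} {X : Finset V} {f : ℕ → V} {p : ℕ}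
    (h : IsPathIn E X f p) (hp : 1 ≤ p) (b : Bool) (v : V) :
    #{u ∈ X | s(v, u) ∈ trackEdges f p b} ≤ 2 := by
  by_cases hv : ∃ j < p, f j = v
  · obtain ⟨j, hj, rfl⟩ := hv
    refine (card_le_card (t := {if j + 1 < p then f (j + 1) else f 0,
      if j = 0 then f (p - 1) else f (j - 1)}) ?_).trans card_le_two
    intro u hu
    have := (mem_filter.mp hu).2
    simp only [mem_insert, mem_singleton]
    rcases this with ⟨l, hl, he⟩ | ⟨-, he⟩
    · rcases Sym2.eq_iff.mp he with ⟨h1, h2⟩ | ⟨h1, h2⟩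
      · have := h.inj _ hj _ (by omega) h1
        subst this
        left; rw [if_pos hl]; exact h2
      · have := h.inj _ hj _ (by omega) h1
        subst this
        right; rw [if_neg (by omega)]; simpa using h2
    · rcases Sym2.eq_iff.mp he with ⟨h1, h2⟩ | ⟨h1, h2⟩
      · have := h.inj _ hj _ (by omega) h1
        subst this
        right; simpa using h2
      · have := h.inj _ hj _ (by omega) h1
        left; rw [if_neg (by omega)]; exact h2
  · have : {u ∈ X | s(v, u) ∈ trackEdges f p b} = ∅ := by
      refine filter_eq_empty_iff.mpr fun u _ he => hv ?_
      rcases he with ⟨l, hl, he⟩ | ⟨-, he⟩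
      · rcases Sym2.eq_iff.mp he with ⟨h1, h2⟩ | ⟨h1, h2⟩
        · exact ⟨l, by omega, h1.symm⟩
        · exact ⟨l + 1, by omega, h1.symm⟩
      · rcases Sym2.eq_iff.mp he with ⟨h1, h2⟩ | ⟨h1, h2⟩
        · exact ⟨0, by omega, h1.symm⟩
        · exact ⟨p - 1, by omega, h1.symm⟩
    rw [this]; simp

/-- Passing from ordered to unordered pairs at most halves the number. -/
theorem card_le_two_mul_card_image_mk [DecidableEq V] (P : Finset (V × V)) :
    #P ≤ 2 * #(P.image fun q => s(q.1, q.2)) := by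
  refine card_le_mul_card_image P 2 fun a ha => ?_
  obtain ⟨⟨x, y⟩, -, rfl⟩ := mem_image.mp ha
  refine (card_le_card (t := {(x, y), (y, x)}) ?_).trans card_le_two
  rintro ⟨u, v⟩ hq
  have := (mem_filter.mp hq).2
  simp only [mem_insert, mem_singleton, Prod.mk.injEq]
  simpa using Sym2.eq_iff.mp this

theorem exists_trackEdges_finset [DecidableEq V] (f : ℕ → V) (p : ℕ) (b : Bool) (hp : 1 ≤ p) :
    ∃ F : Finset (Sym2 V), trackEdges f p b ⊆ F ∧ #F ≤ p := by
  refine ⟨(range p).image fun j => if j + 1 < p then s(f j, f (j + 1)) else s(f 0, f (p - 1)),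
    ?_, card_image_le.trans (card_range p).le⟩
  rintro e (⟨j, hj, rfl⟩ | ⟨-, rfl⟩)
  · exact mem_coe.mpr (mem_image.mpr ⟨j, mem_range.mpr (by omega), by rw [if_pos hj]⟩)
  · exact mem_coe.mpr (mem_image.mpr ⟨p - 1, mem_range.mpr (by omega), by rw [if_neg (by omega)]⟩)

/-- Replacing one open track of a packing by a better one that avoids the edges of all the
others. -/
theorem HasTracks.of_replace {E E' : Set (Sym2 V)} {X : Finset V} {w r d : ℕ}
    {f : Fin r → ℕ → V} {p : Fin r → ℕ} {b : Fin r → Bool}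
    (h1 : ∀ i, IsTrack E X w (f i) (p i) (b i))
    (h2 : Pairwise fun i j =>
      Disjoint (trackEdges (f i) (p i) (b i)) (trackEdges (f j) (p j) (b j)))
    (h3 : r * (#X + 1) ≤ d + 1 + ∑ i, (p i + (b i).toNat)) (hE : E ⊆ E') (i : Fin r)
    {f' : ℕ → V} {p' : ℕ} {b' : Bool}
    (ht : IsTrack (E' \ {e | ∃ j ≠ i, e ∈ trackEdges (f j) (p j) (b j)}) X w f' p' b')
    (hs : p i + (b i).toNat + 1 ≤ p' + b'.toNat) : HasTracks E' X w r d := by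
  classical
  refine ⟨Function.update f i f', Function.update p i p', Function.update b i b', ?_, ?_, ?_⟩
  · intro j
    by_cases hj : j = i
    · subst hj
      simpa using ht.mono Set.sdiff_subset
    · simpa [hj] using (h1 j).mono hE
  · have hdisj : ∀ j ≠ i, Disjoint (trackEdges f' p' b') (trackEdges (f j) (p j) (b j)) := by
      intro j hj
      refine Set.disjoint_left.mpr fun e he he' => ?_
      exact (ht.trackEdges_subset he).2 ⟨j, hj, he'⟩
    intro j l hjl
    by_cases hj : j = i
    · subst hj
      simpa [hjl.symm] using hdisj l hjl.symm
    · by_cases hl : l = i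
      · subst hl
        simpa [hj] using (hdisj j hj).symm
      · simpa [hj, hl] using h2 hjl
  · have e1 := Finset.add_sum_erase univ (fun j => p j + (b j).toNat) (mem_univ i)
    have e2 := Finset.add_sum_erase univ
      (fun j => Function.update p i p' j + (Function.update b i b' j).toNat) (mem_univ i)
    have e3 : ∑ j ∈ univ.erase i,
        (Function.update p i p' j + (Function.update b i b' j).toNat) =
        ∑ j ∈ univ.erase i, (p j + (b j).toNat) := by
      refine sum_congr rfl fun j hj => ?_
      simp [ne_of_mem_erase hj]
    rw [← e2, e3]
    simp only [Function.update_self]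
    have e1' : p i + (b i).toNat + ∑ j ∈ univ.erase i, (p j + (b j).toNat) =
      ∑ i, (p i + (b i).toNat) := e1
    omega

open Classical in
/-- If a family of tracks of deficiency `d + 1` cannot be improved for free, then there are many
pairs inside `W` whose addition to the edge set improves it: the closing edges of all the paths
that arise from an open track by rotations. -/
theorem HasTracks.improve {E : Set (Sym2 V)} {X W : Finset V} {r d s : ℕ} (hWX : W ⊆ X)
    (hW : 2 ≤ #W) (hs : #X ≤ #W + s)
    (hexp : ∀ R : Set (Sym2 V), (∀ v, #{u ∈ X | s(v, u) ∈ R} + 2 ≤ 2 * r) →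
      ∀ S ⊆ X, S.Nonempty → #(outerNeighbors (E \ R) X S) < 2 * #S → s < #S)
    (h : HasTracks E X #W r (d + 1)) :
    HasTracks E X #W r d ∨ ∃ B : Finset (Sym2 V),
      (∀ e ∈ B, e ∉ E ∧ ¬ e.IsDiag ∧ (∀ x ∈ e, x ∈ W) ∧ HasTracks (insert e E) X #W r d) ∧
      (s + 1 + #W - #X) ^ 2 ≤ 2 * (#B + r * #X) := by
  by_cases hd : HasTracks E X #W r d
  · exact Or.inl hd
  right
  obtain ⟨f, p, b, h1, h2, h3⟩ := h
  have hp : ∀ i, 2 ≤ p i := fun i => hW.trans (h1 i).le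
  -- some track is open, since a family of closed tracks has no deficiency
  obtain ⟨i, hi⟩ : ∃ i, b i = false := by
    by_contra hcon
    push Not at hcon
    refine hd ⟨f, p, b, h1, h2, ?_⟩
    have : ∀ i, p i + (b i).toNat = #X + 1 := by
      intro i
      have hb : b i = true := by simpa using hcon i
      rw [((h1 i).closed hb).1, hb]; rfl
    simp [this]
  set R : Set (Sym2 V) := {e | ∃ j ≠ i, e ∈ trackEdges (f j) (p j) (b j)} with hR
  have hdeg : ∀ v, #{u ∈ X | s(v, u) ∈ R} + 2 ≤ 2 * r := by
    intro v
    have hsub : {u ∈ X | s(v, u) ∈ R} ⊆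
        (univ.erase i).biUnion fun j => {u ∈ X | s(v, u) ∈ trackEdges (f j) (p j) (b j)} := by
      intro u hu
      obtain ⟨huX, j, hj, he⟩ := mem_filter.mp hu
      exact mem_biUnion.mpr ⟨j, by simpa using hj, mem_filter.mpr ⟨huX, he⟩⟩
    have hc := (card_le_card hsub).trans (card_biUnion_le_card_mul _ _ 2 fun j _ =>
      card_trackEdges_nbrs_le (h1 j).path (by have := hp j; omega) (b j) v)
    have : #((univ : Finset (Fin r)).erase i) = r - 1 := by simp
    rw [this] at hc
    have := i.pos
    omega
  have hexpR := hexp R fun v => by convert hdeg v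
  have hpath : IsPathIn (E \ R) X (f i) (p i) := by
    refine ⟨(h1 i).path.inj, (h1 i).path.mem, fun l hl => ⟨(h1 i).path.adj l hl, ?_⟩⟩
    rintro ⟨j, hj, he⟩
    exact Set.disjoint_left.mp (h2 hj.symm) (Or.inl ⟨l, hl, rfl⟩) he
  have hmax : ∀ g, ¬ IsPathIn (E \ R) X g (p i + 1) := by
    intro g hg
    refine hd (HasTracks.of_replace h1 h2 h3 le_rfl i (f' := g) (p' := p i + 1) (b' := false)
      ⟨hg, (h1 i).le.trans (Nat.le_succ _), by simp⟩ ?_)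
    simp [hi]
  obtain ⟨A, hAX, hAs, hA⟩ := exists_endpoint_pairs hpath (by have := hp i; omega) hmax hexpR
  choose! T hTX hTs hT using hA
  set P : Finset (V × V) := (A ∩ W).biUnion fun a => (T a ∩ W).image fun b => (a, b) with hP
  have hPmem : ∀ q ∈ P, q.1 ∈ A ∧ q.1 ∈ W ∧ q.2 ∈ T q.1 ∧ q.2 ∈ W := by
    intro q hq
    obtain ⟨a, ha, hq⟩ := mem_biUnion.mp hq
    obtain ⟨c, hc, rfl⟩ := mem_image.mp hq
    simp only [mem_inter] at ha hc
    exact ⟨ha.1, ha.2, hc.1, hc.2⟩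
  set B : Finset (Sym2 V) := {e ∈ P.image fun q => s(q.1, q.2) | e ∉ R} with hB
  refine ⟨B, fun e he => ?_, ?_⟩
  · obtain ⟨he, heR⟩ := mem_filter.mp he
    obtain ⟨⟨a, c⟩, hq, rfl⟩ := mem_image.mp he
    obtain ⟨haA, haW, hcT, hcW⟩ := hPmem _ hq
    simp only at haA haW hcT hcW heR ⊢
    obtain ⟨g, hg, hga, hgc⟩ := hT a haA c hcT
    have hac : a ≠ c := by
      intro hac
      have := hp i
      have := hg.inj 0 (by omega) (p i - 1) (by omega) (by rw [hga, hgc, hac])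
      omega
    have hcl : s(g 0, g (p i - 1)) ∈ insert s(a, c) E \ R := by
      rw [hga, hgc]; exact ⟨Set.mem_insert _ _, heR⟩
    have hsub : E \ R ⊆ insert s(a, c) E \ R :=
      Set.sdiff_subset_sdiff_left (Set.subset_insert _ _)
    -- the new edge closes a path, and the resulting cycle either is Hamiltonian or can be opened to
    -- a longer path
    have himp : HasTracks (insert s(a, c) E) X #W r d := by
      rcases hpath.card_le.lt_or_eq with hlt | heq
      · obtain ⟨g', hg'⟩ := exists_longer_path hg (by have := hp i; omega) hsub hcl hlt
          (by have := (h1 i).le; omega) hexpR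
        refine HasTracks.of_replace h1 h2 h3 (Set.subset_insert _ _) i (f' := g')
          (p' := p i + 1) (b' := false) ⟨hg', (h1 i).le.trans (Nat.le_succ _), by simp⟩ ?_
        simp [hi]
      · refine HasTracks.of_replace h1 h2 h3 (Set.subset_insert _ _) i (f' := g)
          (p' := p i) (b' := true) ⟨hg.mono hsub, (h1 i).le, fun _ => ⟨heq, hcl⟩⟩ ?_
        simp [hi]
    refine ⟨fun heE => hd ?_, by simpa using hac, ?_, himp⟩
    · rwa [Set.insert_eq_of_mem heE] at himp
    · intro x hx
      rcases Sym2.mem_iff.mp hx with rfl | rfl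
      exacts [haW, hcW]
  · have hsd := card_sdiff_add_card_eq_card hWX
    have hinter : ∀ Y ⊆ X, s < #Y → s + 1 + #W - #X ≤ #(Y ∩ W) := by
      intro Y hY hYs
      have h4 : #(Y ∩ W) + #(Y \ W) = #Y := card_inter_add_card_sdiff Y W
      have h5 : #(Y \ W) ≤ #(X \ W) := card_le_card (sdiff_subset_sdiff hY le_rfl)
      omega
    have hPcard : (s + 1 + #W - #X) ^ 2 ≤ #P := by
      rw [hP, card_biUnion]
      · calc (s + 1 + #W - #X) ^ 2 ≤ #(A ∩ W) * (s + 1 + #W - #X) := by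
              rw [sq]; exact Nat.mul_le_mul_right _ (hinter A hAX hAs)
          _ ≤ _ := by
              rw [← smul_eq_mul]
              refine card_nsmul_le_sum _ _ _ fun a ha => ?_
              rw [card_image_of_injective _ (Prod.mk_right_injective a)]
              have haA := (mem_inter.mp ha).1
              exact hinter _ (hTX a haA) (hTs a haA)
      · intro a _ a' _ haa'
        refine Finset.disjoint_left.mpr fun q hq hq' => haa' ?_
        obtain ⟨_, _, rfl⟩ := mem_image.mp hq
        obtain ⟨_, _, hq'⟩ := mem_image.mp hq'
        exact (Prod.mk.inj hq').1.symm
    choose F hF1 hF2 using fun j => exists_trackEdges_finset (f j) (p j) (b j)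
      (by have := hp j; omega)
    have hRF : {e ∈ P.image fun q => s(q.1, q.2) | ¬ e ∉ R} ⊆ univ.biUnion F := by
      intro e he
      obtain ⟨j, -, hej⟩ := not_not.mp (mem_filter.mp he).2
      exact mem_biUnion.mpr ⟨j, mem_univ _, mem_coe.mp (hF1 j hej)⟩
    have hRc : #{e ∈ P.image fun q => s(q.1, q.2) | ¬ e ∉ R} ≤ r * #X := by
      refine (card_le_card hRF).trans ((card_biUnion_le_card_mul _ _ #X fun j _ =>
        (hF2 j).trans (h1 j).path.card_le).trans ?_)
      simp
    have hsplit := card_filter_add_card_filter_not (s := P.image fun q => s(q.1, q.2))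
      (fun e => e ∉ R)
    have h2P := card_le_two_mul_card_image_mk P
    refine hPcard.trans (h2P.trans ?_)
    rw [← hsplit]
    exact Nat.mul_le_mul_left 2 (Nat.add_le_add_left hRc _)

open Classical in
/-- Expansion from local sparsity. If small vertex sets of `E₀` span few more edges than vertices,
then deleting at most `2 * r - 2` of the at least `2 * r + 3` edges at each vertex of `X` leaves a
graph of minimum degree five in which a small set `S` has at least `2 * #S` outer neighbours:
otherwise the union of `S` and its neighbourhood would span too many edges. -/
theorem expansion_of_sparse {E₀ : Finset (Sym2 V)} {X : Finset V} {r L : ℕ} {R : Set (Sym2 V)}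
    (hdiag : ∀ e ∈ E₀, ¬ e.IsDiag)
    (hsparse : ∀ T : Finset V, #T ≤ L → #{e ∈ E₀ | ∀ x ∈ e, x ∈ T} < #T + 3 + #T / 16)
    (hmin : ∀ v ∈ X, 2 * r + 3 ≤ #{u ∈ X | s(v, u) ∈ E₀})
    (hR : ∀ v, #{u ∈ X | s(v, u) ∈ R} + 2 ≤ 2 * r) (S : Finset V) (hSX : S ⊆ X)
    (hS : S.Nonempty) (hN : #(outerNeighbors (↑E₀ \ R) X S) < 2 * #S) : L / 3 < #S := by
  by_contra hcon
  set N := outerNeighbors (↑E₀ \ R) X S with hNdef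
  have hs : 1 ≤ #S := card_pos.mpr hS
  have hdisj : Disjoint S N := by
    rw [Finset.disjoint_right]; intro x hx; exact (mem_outerNeighbors.mp hx).2.1
  have hT : #(S ∪ N) = #S + #N := card_union_of_disjoint hdisj
  have hdeg : ∀ v ∈ X, 5 ≤ #{u ∈ X | s(v, u) ∈ (↑E₀ \ R : Set (Sym2 V))} := by
    intro v hv
    have h1 : {u ∈ X | s(v, u) ∈ E₀} ⊆
        {u ∈ X | s(v, u) ∈ (↑E₀ \ R : Set (Sym2 V))} ∪ {u ∈ X | s(v, u) ∈ R} := by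
      intro u hu
      simp only [mem_filter, mem_union, Set.mem_sdiff, mem_coe] at hu ⊢
      tauto
    have h2 := (card_le_card h1).trans (card_union_le _ _)
    have h3 := hmin v hv
    have h4 := hR v
    omega
  -- ordered pairs along an edge, the first entry in `S`, the second outside or inside `S`
  set P₁ : Finset (V × V) := {q ∈ S ×ˢ N | s(q.1, q.2) ∈ (↑E₀ \ R : Set (Sym2 V))} with hP₁
  set P₂ : Finset (V × V) := {q ∈ S ×ˢ S | s(q.1, q.2) ∈ (↑E₀ \ R : Set (Sym2 V))} with hP₂
  have hcount : 5 * #S ≤ #P₁ + #P₂ := by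
    have h1 : S.biUnion (fun v => ({u ∈ X | s(v, u) ∈ (↑E₀ \ R : Set (Sym2 V))}).image
        fun u => (v, u)) ⊆ P₁ ∪ P₂ := by
      intro q hq
      obtain ⟨v, hv, hq⟩ := mem_biUnion.mp hq
      obtain ⟨u, hu, rfl⟩ := mem_image.mp hq
      obtain ⟨huX, hu⟩ := mem_filter.mp hu
      by_cases huS : u ∈ S
      · exact mem_union_right _ (mem_filter.mpr ⟨mem_product.mpr ⟨hv, huS⟩, hu⟩)
      · exact mem_union_left _ (mem_filter.mpr ⟨mem_product.mpr ⟨hv,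
          mem_outerNeighbors.mpr ⟨huX, huS, v, hv, hu⟩⟩, hu⟩)
    refine le_trans ?_ ((card_le_card h1).trans (card_union_le _ _))
    rw [card_biUnion]
    · rw [mul_comm, ← smul_eq_mul]
      refine card_nsmul_le_sum _ _ _ fun v hv => ?_
      rw [card_image_of_injective _ (Prod.mk_right_injective v)]
      exact hdeg v (hSX hv)
    · intro a _ a' _ haa'
      refine Finset.disjoint_left.mpr fun q hq hq' => haa' ?_
      obtain ⟨_, _, rfl⟩ := mem_image.mp hq
      obtain ⟨_, _, hq'⟩ := mem_image.mp hq'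
      exact (Prod.mk.inj hq').1.symm
  have hP₂off : #P₂ ≤ #S * #S - #S := by
    rw [← offDiag_card]
    refine card_le_card fun q hq => ?_
    obtain ⟨hq, he⟩ := mem_filter.mp hq
    obtain ⟨h1, h2⟩ := mem_product.mp hq
    refine mem_offDiag.mpr ⟨h1, h2, fun h => ?_⟩
    exact hdiag _ he.1 (by simpa using h)
  have hP₂e : #P₂ ≤ 2 * #{e ∈ E₀ | ∀ x ∈ e, x ∈ S} := by
    refine (card_le_two_mul_card_image_mk P₂).trans (Nat.mul_le_mul_left 2 (card_le_card ?_))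
    intro e he
    obtain ⟨q, hq, rfl⟩ := mem_image.mp he
    obtain ⟨hq, he⟩ := mem_filter.mp hq
    obtain ⟨h1, h2⟩ := mem_product.mp hq
    refine mem_filter.mpr ⟨he.1, fun x hx => ?_⟩
    rcases Sym2.mem_iff.mp hx with rfl | rfl
    exacts [h1, h2]
  have hP₁e : #P₁ + #{e ∈ E₀ | ∀ x ∈ e, x ∈ S} ≤ #{e ∈ E₀ | ∀ x ∈ e, x ∈ S ∪ N} := by
    rw [← card_image_of_injOn (s := P₁) (f := fun q => s(q.1, q.2)), ← card_union_of_disjoint]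
    · refine card_le_card (union_subset ?_ ?_)
      · intro e he
        obtain ⟨q, hq, rfl⟩ := mem_image.mp he
        obtain ⟨hq, he⟩ := mem_filter.mp hq
        obtain ⟨h1, h2⟩ := mem_product.mp hq
        refine mem_filter.mpr ⟨he.1, fun x hx => ?_⟩
        rcases Sym2.mem_iff.mp hx with rfl | rfl
        exacts [mem_union_left _ h1, mem_union_right _ h2]
      · exact monotone_filter_right _ fun e _ he x hx => mem_union_left _ (he x hx)
    · refine Finset.disjoint_left.mpr fun e he he' => ?_
      obtain ⟨q, hq, rfl⟩ := mem_image.mp he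
      obtain ⟨h1, h2⟩ := mem_product.mp (mem_filter.mp hq).1
      exact Finset.disjoint_left.mp hdisj ((mem_filter.mp he').2 q.2 (Sym2.mem_mk_right _ _)) h2
    · intro q hq q' hq' hqq'
      obtain ⟨h1, h2⟩ := mem_product.mp (mem_filter.mp hq).1
      obtain ⟨h1', h2'⟩ := mem_product.mp (mem_filter.mp hq').1
      rcases Sym2.eq_iff.mp hqq' with ⟨h3, h4⟩ | ⟨h3, h4⟩
      · exact Prod.ext h3 h4
      · exact absurd (h3 ▸ h1 : q'.2 ∈ S) (Finset.disjoint_right.mp hdisj h2')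
  have hsS := hsparse S (by omega)
  have hsT := hsparse (S ∪ N) (by omega)
  rw [hT] at hsT
  -- for `#S ≤ 3` the trivial bound on the number of edges inside `S` is needed
  by_cases h4 : #S ≤ 3
  · have : #S = 1 ∨ #S = 2 ∨ #S = 3 := by omega
    rcases this with h | h | h <;> rw [h] at hP₂off <;> omega
  · omega

end Packings

/-! ### The core and its vertex set -/

section Core

variable {V : Type*} [Fintype V]

open Classical in
/-- The vertex set of the `k`-core. -/
noncomputable def coreSet (G : SimpleGraph V) (k : ℕ) : Finset V :=
  {v | v ∈ (kCore G k).verts}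

theorem mem_coreSet {G : SimpleGraph V} {k : ℕ} {v : V} :
    v ∈ coreSet G k ↔ v ∈ (kCore G k).verts := by
  classical
  simp [coreSet]

open Classical in
/-- A vertex set inducing a subgraph of minimum degree at least `k` lies in the `k`-core. -/
theorem subset_coreSet {G : SimpleGraph V} {k : ℕ} {X : Finset V}
    (hX : ∀ v ∈ X, k ≤ #{u ∈ X | G.Adj v u}) : X ⊆ coreSet G k := by
  have hmem : (⊤ : G.Subgraph).induce (X : Set V) ∈ {K : G.Subgraph | MinDegreeGE K k} := by
    intro v hv
    have hv' : v ∈ X := hv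
    have h1 : ((⊤ : G.Subgraph).induce (X : Set V)).neighborSet v =
        (({u ∈ X | G.Adj v u} : Finset V) : Set V) := by
      ext u
      simp [hv']
    rw [h1, Set.encard_coe_eq_coe_finsetCard]
    exact_mod_cast hX v hv'
  have := (kCore_isGreatest G k).2 hmem
  intro v hv
  exact mem_coreSet.mpr (this.1 (by simpa using hv))

open Classical in
theorem le_card_coreSet_nbrs {G : SimpleGraph V} {k : ℕ} :
    ∀ v ∈ coreSet G k, k ≤ #{u ∈ coreSet G k | G.Adj v u} := by
  intro v hv
  have h1 := (kCore_isGreatest G k).1 v (mem_coreSet.mp hv)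
  have h2 : (kCore G k).neighborSet v ⊆
      (({u ∈ coreSet G k | G.Adj v u} : Finset V) : Set V) := by
    intro u hu
    have hu' : (kCore G k).Adj v u := hu
    simp only [coe_filter, Set.mem_ofPred_eq]
    exact ⟨mem_coreSet.mpr ((kCore G k).edge_vert hu'.symm), (kCore G k).adj_sub hu'⟩
  have h3 := h1.trans (Set.encard_le_encard h2)
  rw [Set.encard_coe_eq_coe_finsetCard] at h3
  exact_mod_cast h3

/-- The core is an induced subgraph. -/
theorem kCore_adj_iff {G : SimpleGraph V} {k : ℕ} {x y : V} :
    (kCore G k).Adj x y ↔ x ∈ coreSet G k ∧ y ∈ coreSet G k ∧ G.Adj x y := by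
  classical
  constructor
  · intro h
    exact ⟨mem_coreSet.mpr ((kCore G k).edge_vert h),
      mem_coreSet.mpr ((kCore G k).edge_vert h.symm), (kCore G k).adj_sub h⟩
  · rintro ⟨hx, hy, h⟩
    have hmem : (⊤ : G.Subgraph).induce (kCore G k).verts ∈
        {K : G.Subgraph | MinDegreeGE K k} := by
      intro v hv
      refine ((kCore_isGreatest G k).1 v hv).trans (Set.encard_le_encard fun u hu => ?_)
      have hu' : (kCore G k).Adj v u := hu
      exact ⟨(kCore G k).edge_vert hu', (kCore G k).edge_vert hu'.symm, (kCore G k).adj_sub hu'⟩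
    have := (kCore_isGreatest G k).2 hmem
    exact this.2 ⟨mem_coreSet.mp hx, mem_coreSet.mp hy, h⟩

theorem coreSet_mono {G G' : SimpleGraph V} (h : G ≤ G') (k : ℕ) :
    coreSet G k ⊆ coreSet G' k := by
  classical
  refine subset_coreSet fun v hv => (le_card_coreSet_nbrs v hv).trans (card_le_card ?_)
  exact monotone_filter_right _ fun u _ hu => h hu

/-- Edges added inside the core do not change the vertex set of the core. -/
theorem coreSet_eq_of_le {H G₀ G : SimpleGraph V} {k : ℕ} (h0 : H ≤ G₀) (h1 : G₀ ≤ G)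
    (h : ∀ x y, G.Adj x y → G₀.Adj x y ∨ (x ∈ coreSet H k ∧ y ∈ coreSet H k)) :
    coreSet G k = coreSet G₀ k := by
  classical
  refine Subset.antisymm (subset_coreSet fun v hv => ?_) (coreSet_mono h1 k)
  by_cases hvH : v ∈ coreSet H k
  · refine (le_card_coreSet_nbrs v hvH).trans (card_le_card fun u hu => ?_)
    obtain ⟨hu1, hu2⟩ := mem_filter.mp hu
    exact mem_filter.mpr ⟨coreSet_mono (h0.trans h1) k hu1, h0 hu2⟩
  · refine (le_card_coreSet_nbrs v hv).trans (card_le_card fun u hu => ?_)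
    obtain ⟨hu1, hu2⟩ := mem_filter.mp hu
    refine mem_filter.mpr ⟨hu1, (h v u hu2).resolve_right fun h' => hvH h'.1⟩

open Classical in
/-- Peeling: if at least `x` vertices lie outside the `k`-core, then removing successively `x`
vertices of current degree below `k` produces a set of `x` vertices that meets at most `k * x`
edges. -/
theorem exists_peeled {G : SimpleGraph V} {k : ℕ} {E : Finset (Sym2 V)}
    (hE : (E : Set (Sym2 V)) = G.edgeSet) (x : ℕ) (hx : x + #(coreSet G k) ≤ Fintype.card V) :
    ∃ X : Finset V, #X = x ∧ Disjoint X (coreSet G k) ∧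
      #{e ∈ E | ∃ v ∈ e, v ∈ X} ≤ k * x := by
  induction x with
  | zero => exact ⟨∅, by simp, by simp, by simp⟩
  | succ x ih =>
    obtain ⟨X, hX, hd, hc⟩ := ih (by omega)
    have hmemE : ∀ e, e ∈ E ↔ e ∈ G.edgeSet := fun e => by rw [← hE]; simp
    obtain ⟨v, hvX, hv⟩ : ∃ v ∈ Xᶜ, #{u ∈ Xᶜ | G.Adj v u} < k := by
      by_contra hcon
      push Not at hcon
      have h1 := card_le_card (subset_coreSet hcon)
      rw [card_compl] at h1
      omega
    have hvX' : v ∉ X := by simpa using hvX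
    refine ⟨insert v X, by rw [card_insert_of_notMem hvX', hX], ?_, ?_⟩
    · rw [disjoint_insert_left]
      refine ⟨fun hvc => ?_, hd⟩
      have h1 := le_card_coreSet_nbrs v hvc
      have h2 : {u ∈ coreSet G k | G.Adj v u} ⊆ {u ∈ Xᶜ | G.Adj v u} := by
        intro u hu
        obtain ⟨hu1, hu2⟩ := mem_filter.mp hu
        exact mem_filter.mpr ⟨mem_compl.mpr fun h => Finset.disjoint_left.mp hd h hu1, hu2⟩
      have := card_le_card h2
      omega
    · have hsub : {e ∈ E | ∃ w ∈ e, w ∈ insert v X} ⊆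
          {e ∈ E | ∃ w ∈ e, w ∈ X} ∪ ({u ∈ Xᶜ | G.Adj v u}).image fun u => s(v, u) := by
        intro e he
        obtain ⟨heE, w, hwe, hw⟩ := mem_filter.mp he
        by_cases hX' : ∃ w ∈ e, w ∈ X
        · exact mem_union_left _ (mem_filter.mpr ⟨heE, hX'⟩)
        · refine mem_union_right _ ?_
          rcases mem_insert.mp hw with rfl | hw
          swap
          · exact absurd ⟨w, hwe, hw⟩ hX'
          obtain ⟨u, rfl⟩ := Sym2.mem_iff_exists.mp hwe
          refine mem_image.mpr ⟨u, mem_filter.mpr ⟨mem_compl.mpr fun hu =>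
            hX' ⟨u, Sym2.mem_mk_right _ _, hu⟩, ?_⟩, rfl⟩
          exact (SimpleGraph.mem_edgeSet G).mp ((hmemE _).mp heE)
      have h1 := (card_le_card hsub).trans (card_union_le _ _)
      have h2 : #(({u ∈ Xᶜ | G.Adj v u}).image fun u => s(v, u)) ≤ #{u ∈ Xᶜ | G.Adj v u} :=
        card_image_le
      rw [mul_add]
      omega

end Core

/-! ### Hamilton cycles of the core as tracks -/

section Hamilton

variable {V : Type*} [Fintype V]

/-- A sequence of adjacent vertices as a walk. -/
theorem exists_walk_of_adj {β : Type*} {G : SimpleGraph β} (g : ℕ → β) (p : ℕ)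
    (h : ∀ j < p, G.Adj (g j) (g (j + 1))) :
    ∃ w : G.Walk (g 0) (g p), w.length = p ∧ w.support = (List.range (p + 1)).map g ∧
      ∀ e ∈ w.edges, ∃ j < p, e = s(g j, g (j + 1)) := by
  induction p with
  | zero => exact ⟨.nil, rfl, by simp, by simp⟩
  | succ p ih =>
    obtain ⟨w, h1, h2, h3⟩ := ih fun j hj => h j (by omega)
    refine ⟨w.concat (h p (by omega)), by simp [h1], ?_, ?_⟩
    · rw [SimpleGraph.Walk.support_concat, h2, List.range_succ (n := p + 1), List.map_append]
      rfl
    · intro e he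
      rw [SimpleGraph.Walk.edges_concat, List.concat_eq_append, List.mem_append] at he
      rcases he with he | he
      · obtain ⟨j, hj, rfl⟩ := h3 e he
        exact ⟨j, by omega, rfl⟩
      · exact ⟨p, by omega, by simpa using he⟩

theorem card_kCore_verts {G : SimpleGraph V} {k : ℕ} [Fintype (kCore G k).verts] :
    Fintype.card (kCore G k).verts = #(coreSet G k) := by
  classical
  rw [← Set.toFinset_card]
  congr 1
  ext v
  simp [mem_coreSet]

/-- Removing an edge from each Hamilton cycle of a packing leaves edge-disjoint paths through all
vertices of the core. -/
theorem CoreHasPacking.hasTracks {G : SimpleGraph V} {k : ℕ} (h : CoreHasPacking G k)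
    {X : Finset V} (hX : coreSet G k ⊆ X) :
    HasTracks G.edgeSet X #(coreSet G k) ((k - 3) / 2)
      ((k - 3) / 2 * (#X + 1 - #(coreSet G k))) := by
  classical
  obtain ⟨v, C, hC', hdisj⟩ := h
  have hC : ∀ i, (C i).IsHamiltonianCycle := fun i => by convert! hC' i
  have hlen : ∀ i, (C i).length = #(coreSet G k) := by
    intro i
    rw [← card_kCore_verts]
    exact (hC i).length_eq
  have hedge : ∀ i j, j + 1 < #(coreSet G k) →
      s((C i).getVert j, (C i).getVert (j + 1)) ∈ (C i).edges := by
    intro i j hj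
    rw [← SimpleGraph.Walk.mem_edges_toSubgraph]
    exact (C i).toSubgraph_adj_getVert (by rw [hlen]; omega)
  refine ⟨fun i j => ((C i).getVert j : V), fun _ => #(coreSet G k), fun _ => false, ?_, ?_, ?_⟩
  · refine fun i => ⟨⟨fun a ha b hb hab => ?_, fun a _ => ?_, fun a ha => ?_⟩, le_rfl, by simp⟩
    · beta_reduce at ha hb
      refine (hC i).isCycle.getVert_injOn' ?_ ?_ (Subtype.ext hab)
      · simp only [Set.mem_ofPred_eq, hlen]; omega
      · simp only [Set.mem_ofPred_eq, hlen]; omega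
    · exact hX (mem_coreSet.mpr ((C i).getVert a).2)
    · beta_reduce at ha
      have := (C i).adj_getVert_succ (i := a) (by rw [hlen]; omega)
      exact (kCore G k).adj_sub this
  · intro i j hij
    refine Set.disjoint_left.mpr ?_
    rintro e (⟨a, ha, rfl⟩ | ⟨h, -⟩) (⟨b, hb, hab⟩ | ⟨h', -⟩)
    · have hinj : Function.Injective (Sym2.map (Subtype.val : (kCore G k).verts → V)) :=
        Sym2.map.injective Subtype.val_injective
      have heq : s((C i).getVert a, (C i).getVert (a + 1)) =
          s((C j).getVert b, (C j).getVert (b + 1)) := hinj (by simpa using hab)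
      exact Set.disjoint_left.mp (hdisj hij) (hedge i a ha) (by
        rw [heq]; exact hedge j b hb)
    · simp at h'
    · simp at h
    · simp at h
  · have hc := card_le_card hX
    simp only [Bool.toNat_false, add_zero, sum_const, card_univ, Fintype.card_fin, smul_eq_mul]
    rw [← mul_add]
    exact Nat.mul_le_mul_left _ (by omega)

/-- Tracks without any deficiency are Hamilton cycles of the core. -/
theorem HasTracks.coreHasPacking {G : SimpleGraph V} {k w : ℕ} (hw : 3 ≤ w)
    (h : HasTracks G.edgeSet (coreSet G k) w ((k - 3) / 2) 0) : CoreHasPacking G k := by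
  classical
  obtain ⟨f, p, b, h1, h2, h3⟩ := h
  have hb : ∀ i, b i = true := by
    by_contra hcon
    push Not at hcon
    obtain ⟨i, hi⟩ := hcon
    have hlt : ∑ i, (p i + (b i).toNat) < ∑ _i : Fin ((k - 3) / 2), (#(coreSet G k) + 1) := by
      refine sum_lt_sum (fun j _ => ?_) ⟨i, mem_univ _, ?_⟩
      · have := (h1 j).path.card_le
        have := Bool.toNat_le (b j)
        omega
      · have := (h1 i).path.card_le
        have hbi : b i = false := by simpa using hi
        rw [hbi]
        simp only [Bool.toNat_false]
        omega
    simp only [sum_const, card_univ, Fintype.card_fin, smul_eq_mul] at hlt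
    omega
  have hp : ∀ i, p i = #(coreSet G k) := fun i => ((h1 i).closed (hb i)).1
  have hp3 : ∀ i, 3 ≤ p i := fun i => hw.trans (h1 i).le
  have hcycle : ∀ i, ∃ (v : (kCore G k).verts) (C : (kCore G k).coe.Walk v v),
      C.IsHamiltonianCycle ∧
        ∀ e ∈ C.edges, Sym2.map Subtype.val e ∈ trackEdges (f i) (p i) (b i) := by
    intro i
    have hcl := ((h1 i).closed (hb i)).2
    have h3i := hp3 i
    have hpath := (h1 i).path
    have hmem : ∀ j < p i, f i j ∈ (kCore G k).verts := fun j hj =>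
      mem_coreSet.mp (hpath.mem j hj)
    -- values at positions from `p i` on are irrelevant
    set g : ℕ → (kCore G k).verts := fun j =>
      if hj : j < p i then ⟨f i j, hmem j hj⟩ else ⟨f i 0, hmem 0 (by omega)⟩ with hg
    have hgv : ∀ j < p i, (g j : V) = f i j := by
      intro j hj; simp only [hg, dif_pos hj]
    obtain ⟨w', hl, hs, he⟩ := exists_walk_of_adj (G := (kCore G k).coe) g (p i - 1) (by
      intro j hj
      simp only [SimpleGraph.Subgraph.coe_adj]
      rw [hgv j (by omega), hgv (j + 1) (by omega)]
      exact kCore_adj_iff.mpr ⟨hpath.mem _ (by omega), hpath.mem _ (by omega),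
        hpath.adj j (by omega)⟩)
    have hadj : (kCore G k).coe.Adj (g (p i - 1)) (g 0) := by
      simp only [SimpleGraph.Subgraph.coe_adj]
      rw [hgv _ (by omega), hgv _ (by omega)]
      refine kCore_adj_iff.mpr ⟨hpath.mem _ (by omega), hpath.mem _ (by omega), ?_⟩
      exact ((SimpleGraph.mem_edgeSet G).mp hcl).symm
    have hginj : ∀ a < p i, ∀ c < p i, g a = g c → a = c := by
      intro a ha c hc hac
      exact hpath.inj a ha c hc (by rw [← hgv a ha, ← hgv c hc, hac])
    refine ⟨_, .cons hadj w', ?_, ?_⟩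
    · rw [SimpleGraph.Walk.isHamiltonianCycle_iff_isCycle_and_length_eq]
      constructor
      · rw [SimpleGraph.Walk.cons_isCycle_iff]
        refine ⟨SimpleGraph.Walk.IsPath.mk' ?_, fun hmem' => ?_⟩
        · rw [hs, show p i - 1 + 1 = p i by omega]
          refine List.Nodup.map_on (fun a ha c hc hac => ?_) List.nodup_range
          exact hginj a (by simpa using ha) c (by simpa using hc) hac
        · obtain ⟨j, hj, hjj⟩ := he _ hmem'
          rcases Sym2.eq_iff.mp hjj with ⟨h4, h5⟩ | ⟨h4, h5⟩
          · have := hginj _ (by omega) _ (by omega) h4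
            omega
          · have := hginj _ (by omega) _ (by omega) h4
            have := hginj _ (by omega) _ (by omega) h5
            omega
      · rw [card_kCore_verts, SimpleGraph.Walk.length_cons, hl, ← hp i]
        omega
    · intro e hmem'
      rw [SimpleGraph.Walk.edges_cons, List.mem_cons] at hmem'
      rcases hmem' with rfl | hmem'
      · right
        refine ⟨hb i, ?_⟩
        rw [Sym2.map_mk]
        simp only [hgv (p i - 1) (by omega), hgv 0 (by omega)]
        exact Sym2.eq_swap
      · obtain ⟨j, hj, rfl⟩ := he _ hmem'
        left
        refine ⟨j, by omega, ?_⟩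
        rw [Sym2.map_mk]
        simp only [hgv j (by omega), hgv (j + 1) (by omega)]
  choose v C hC hCe using hcycle
  refine ⟨v, C, fun i => by convert! hC i, fun i j hij => ?_⟩
  refine Set.disjoint_left.mpr fun e he he' => ?_
  exact Set.disjoint_left.mp (h2 hij) (hCe i e he) (hCe j e he')

end Hamilton

/-! ### Sprinkling edges inside the core -/

section Sprinkling

variable {V : Type*}

/-- The graph with a given finite set of edges. -/
def graphOf (E : Finset (Sym2 V)) : SimpleGraph V := SimpleGraph.fromEdgeSet (E : Set (Sym2 V))

theorem edgeSet_graphOf {E : Finset (Sym2 V)} (hE : ∀ e ∈ E, ¬ e.IsDiag) :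
    (graphOf E).edgeSet = E := by
  rw [graphOf, SimpleGraph.edgeSet_fromEdgeSet]
  ext e
  simp only [Set.mem_sdiff, mem_coe]
  exact ⟨fun h => h.1, fun h => ⟨h, hE e h⟩⟩

theorem graphOf_adj {E : Finset (Sym2 V)} (hE : ∀ e ∈ E, ¬ e.IsDiag) {x y : V} :
    (graphOf E).Adj x y ↔ s(x, y) ∈ E := by
  rw [← SimpleGraph.mem_edgeSet, edgeSet_graphOf hE, mem_coe]

theorem graphOf_mono {E E' : Finset (Sym2 V)} (h : E ⊆ E') : graphOf E ≤ graphOf E' :=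
  SimpleGraph.fromEdgeSet_mono (by exact_mod_cast h)

/-- Every vertex set of size at most `L` spans few more edges of `E` than it has vertices. -/
def LocallySparse (E : Finset (Sym2 V)) (L : ℕ) : Prop :=
  open Classical in ∀ T : Finset V, #T ≤ L → #{e ∈ E | ∀ x ∈ e, x ∈ T} < #T + 3 + #T / 16

theorem LocallySparse.anti {E E' : Finset (Sym2 V)} {L : ℕ} (h : LocallySparse E' L)
    (hE : E ⊆ E') : LocallySparse E L := by
  classical
  intro T hT
  refine lt_of_le_of_lt (card_le_card ?_) (h T hT)
  exact filter_subset_filter _ hE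

theorem outerNeighbors_mono {E E' : Set (Sym2 V)} (h : E ⊆ E') (X S : Finset V) :
    outerNeighbors E X S ⊆ outerNeighbors E' X S := by
  intro w hw
  obtain ⟨h1, h2, u, hu, he⟩ := mem_outerNeighbors.mp hw
  exact mem_outerNeighbors.mpr ⟨h1, h2, u, hu, h he⟩

open Classical in
/-- Let the core of the graph with edge set `E` have a packing and miss at most `D` vertices, and
let `F₁` be further edges that keep the graph locally sparse. If `t` random pairs of vertices of the
core are added as well, then the probability that the core of the resulting graph has no packing is
exponentially small. -/
theorem card_sprinkle_fail_le [Fintype V] [DecidableEq V] {E F₁ Q : Finset (Sym2 V)}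
    {k L D : ℕ} {β : ℝ}
    (hE : ∀ e ∈ E, ¬ e.IsDiag) (hF₁ : ∀ e ∈ F₁, ¬ e.IsDiag) (hk : 3 ≤ k)
    (hsparse : LocallySparse (E ∪ F₁) L)
    (hpack : CoreHasPacking (graphOf E) k)
    (hW3 : 3 ≤ #(coreSet (graphOf E) k))
    (hW : Fintype.card V ≤ #(coreSet (graphOf E) k) + D) (hD : D ≤ L / 3)
    (hQ : ∀ e, e ∈ Q ↔ e ∉ E ∧ ¬ e.IsDiag ∧ ∀ x ∈ e, x ∈ coreSet (graphOf E) k)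
    (hβ0 : 0 ≤ β) (hβ1 : β ≤ 1)
    (hβ : 2 * (β * #Q + (k - 3) / 2 * Fintype.card V) ≤ ((L / 3 + 1 : ℕ) - D : ℝ) ^ 2) (t : ℕ) :
    (#{F ∈ Q.powersetCard t | ¬ CoreHasPacking (graphOf (E ∪ F₁ ∪ F)) k} : ℝ) ≤
      (#Q).choose t * ((1 - β / 2) ^ t * 2 ^ ((k - 3) / 2 * (D + 1))) := by
  set r := (k - 3) / 2 with hr
  set W := coreSet (graphOf E) k with hWdef
  set X := coreSet (graphOf (E ∪ F₁)) k with hXdef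
  have hWX : W ⊆ X := coreSet_mono (graphOf_mono subset_union_left) k
  have hXV : #X ≤ Fintype.card V := card_le_univ X
  have hEF : ∀ e ∈ E ∪ F₁, ¬ e.IsDiag := by
    intro e he
    rcases mem_union.mp he with he | he
    exacts [hE e he, hF₁ e he]
  have hQd : ∀ F ⊆ Q, ∀ e ∈ E ∪ F₁ ∪ F, ¬ e.IsDiag := by
    intro F hF e he
    rcases mem_union.mp he with he | he
    exacts [hEF e he, ((hQ e).mp (hF he)).2.1]
  -- expansion is needed only in the graph before sprinkling, as further edges preserve it
  have hexp : ∀ R' : Finset (Sym2 V), ∀ R : Set (Sym2 V),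
      (∀ v, #{u ∈ X | s(v, u) ∈ R} + 2 ≤ 2 * r) → ∀ S ⊆ X, S.Nonempty →
      #(outerNeighbors (↑(E ∪ F₁ ∪ R') \ R) X S) < 2 * #S → L / 3 < #S := by
    intro R' R hR S hSX hS hN
    refine expansion_of_sparse hEF hsparse (fun v hv => ?_) hR S hSX hS
      (lt_of_le_of_lt (card_le_card (outerNeighbors_mono ?_ X S)) hN)
    · have h1 := le_card_coreSet_nbrs v hv
      have h2 : {u ∈ X | (graphOf (E ∪ F₁)).Adj v u} ⊆ {u ∈ X | s(v, u) ∈ E ∪ F₁} :=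
        monotone_filter_right _ fun u _ hu => (graphOf_adj hEF).mp hu
      have h3 : 2 * r + 3 ≤ #{u ∈ X | s(v, u) ∈ E ∪ F₁} := by
        have := h1.trans (card_le_card h2)
        omega
      convert h3
    · exact Set.sdiff_subset_sdiff_left (by exact_mod_cast subset_union_left)
  have hmain := card_fail_le Q (fun d R => HasTracks ((E ∪ F₁ ∪ R : Finset (Sym2 V)) :
      Set (Sym2 V)) X #W r d)
    (fun d R R' hRR' h => h.mono (by exact_mod_cast union_subset_union_right hRR')) β hβ0 hβ1 ?_
    t (r * (#X + 1 - #W)) ∅ (empty_subset _) ?_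
  · simp only [empty_union, sdiff_empty] at hmain
    have hexpo : r * (#X + 1 - #W) ≤ r * (D + 1) := Nat.mul_le_mul_left _ (by omega)
    refine le_trans ?_ (hmain.trans ?_)
    · refine Nat.cast_le.mpr (card_le_card fun F hF => ?_)
      obtain ⟨hF, hbad⟩ := mem_filter.mp hF
      refine mem_filter.mpr ⟨hF, fun hgood => hbad ?_⟩
      have hFQ := (mem_powersetCard.mp hF).1
      -- edges inside the core of the first graph leave the core of the second one unchanged
      have hcore : coreSet (graphOf (E ∪ F₁ ∪ F)) k = X := by
        refine coreSet_eq_of_le (H := graphOf E) (graphOf_mono subset_union_left)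
          (graphOf_mono subset_union_left) fun x y hxy => ?_
        rcases mem_union.mp ((graphOf_adj (hQd F hFQ)).mp hxy) with h | h
        · exact Or.inl ((graphOf_adj hEF).mpr h)
        · have := ((hQ _).mp (hFQ h)).2.2
          exact Or.inr ⟨this x (Sym2.mem_mk_left _ _), this y (Sym2.mem_mk_right _ _)⟩
      refine HasTracks.coreHasPacking hW3 ?_
      rw [edgeSet_graphOf (hQd F hFQ), hcore]
      exact hgood
    · have hρ : 0 ≤ 1 - β / 2 := by linarith
      gcongr
      norm_num
  · intro d R hR hA
    refine (HasTracks.improve hWX (by omega) (s := L / 3) (by omega) (hexp R) hA).imp id ?_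
    rintro ⟨B, hB, hBc⟩
    have hBsub : B ⊆ {e ∈ Q \ R | HasTracks ((E ∪ F₁ ∪ insert e R : Finset (Sym2 V)) :
        Set (Sym2 V)) X #W r d} := by
      intro e he
      obtain ⟨h1, h2, h3, h4⟩ := hB e he
      simp only [mem_coe, mem_union, not_or] at h1
      refine mem_filter.mpr ⟨Finset.mem_sdiff.mpr ⟨(hQ e).mpr ⟨h1.1.1, h2, h3⟩, h1.2⟩, ?_⟩
      rw [union_insert, coe_insert]
      exact h4
    refine le_trans ?_ (Nat.cast_le.mpr (card_le_card hBsub))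
    have h1 : L / 3 + 1 - D ≤ L / 3 + 1 + #W - #X := by omega
    have h2 : (L / 3 + 1 - D) ^ 2 ≤ 2 * (#B + r * Fintype.card V) :=
      (Nat.pow_le_pow_left h1 2).trans (hBc.trans (by gcongr))
    have h3 : ((L / 3 + 1 : ℕ) - D : ℝ) ^ 2 ≤ 2 * (#B + r * Fintype.card V) := by
      rw [← Nat.cast_sub (by omega)]
      exact_mod_cast h2
    have h4 : (r : ℝ) ≤ (k - 3) / 2 := by
      rw [hr]
      refine Nat.cast_div_le.trans ?_
      rw [Nat.cast_sub hk]; norm_num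
    have h5 : (r : ℝ) * Fintype.card V ≤ (k - 3) / 2 * Fintype.card V := by gcongr
    linarith
  · have := hpack.hasTracks hWX
    rw [edgeSet_graphOf hE] at this
    exact this.mono (by simp)

end Sprinkling

/-! ### From random graphs to counting edge sets -/

section Counting

/-- Integration against the uniform distribution on a set that is parametrized injectively by a
finset. -/
theorem tsum_uniformOr_mul {α β : Type*} [Finite α] (P : Finset β) (hP : P.Nonempty) (φ : β → α)
    (hφ : Set.InjOn φ P) (s : Set α) (hs : s = φ '' P) (a : α) (g : α → ENNReal) :
    ∑' x, uniformOr s a x * g x = (#P : ENNReal)⁻¹ * ∑ x ∈ P, g (φ x) := by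
  classical
  have hfin : s.toFinite.toFinset = P.image φ := by
    ext x; simp [hs]
  have hne : s.toFinite.toFinset.Nonempty := by rw [hfin]; exact hP.image φ
  rw [uniformOr, dif_pos hne]
  have hcard : #(P.image φ) = #P := card_image_of_injOn hφ
  rw [tsum_eq_sum (s := P.image φ), sum_image hφ, mul_sum]
  · refine sum_congr rfl fun x hx => ?_
    rw [PMF.uniformOfFinset_apply_of_mem, hfin, hcard]
    rw [hfin]; exact mem_image_of_mem φ hx
  · intro x hx
    rw [PMF.uniformOfFinset_apply_of_notMem, zero_mul]
    rwa [hfin]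

open Classical in
theorem toOuterMeasure_uniformOr {α β : Type*} [Finite α] (P : Finset β) (hP : P.Nonempty)
    (φ : β → α) (hφ : Set.InjOn φ P) (s : Set α) (hs : s = φ '' P) (a : α) (t : Set α) :
    (uniformOr s a).toOuterMeasure t = (#P : ENNReal)⁻¹ * #{x ∈ P | φ x ∈ t} := by
  rw [PMF.toOuterMeasure_apply]
  have h1 : ∀ x, t.indicator (uniformOr s a) x = uniformOr s a x * t.indicator 1 x := by
    intro x
    by_cases hx : x ∈ t <;> simp [hx]
  simp_rw [h1]
  rw [tsum_uniformOr_mul P hP φ hφ s hs a, card_filter]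
  push_cast
  congr 1

/-- The set of all pairs of distinct vertices of `Fin n`. -/
def allPairs (n : ℕ) : Finset (Sym2 (Fin n)) := {e | ¬ e.IsDiag}

theorem mem_allPairs {n : ℕ} {e : Sym2 (Fin n)} : e ∈ allPairs n ↔ ¬ e.IsDiag := by
  simp [allPairs]

theorem card_allPairs (n : ℕ) : #(allPairs n) = n.choose 2 := by
  have h := Sym2.card_subtype_not_diag (α := Fin n)
  rw [Fintype.card_subtype, Fintype.card_fin] at h
  exact h

theorem exists_graphOf_eq {n : ℕ} (G : SimpleGraph (Fin n)) :
    ∃ E ⊆ allPairs n, graphOf E = G ∧ (E : Set (Sym2 (Fin n))) = G.edgeSet := by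
  classical
  refine ⟨G.edgeSet.toFinite.toFinset, fun e he => ?_, ?_, by simp⟩
  · exact mem_allPairs.mpr (G.not_isDiag_of_mem_edgeSet (by simpa using he))
  · rw [graphOf, Set.Finite.coe_toFinset, SimpleGraph.fromEdgeSet_edgeSet]

theorem not_isDiag_of_subset {n : ℕ} {E : Finset (Sym2 (Fin n))} (hE : E ⊆ allPairs n) :
    ∀ e ∈ E, ¬ e.IsDiag := fun _ he => mem_allPairs.mp (hE he)

theorem graphOf_injOn {n : ℕ} {E E' : Finset (Sym2 (Fin n))} (hE : E ⊆ allPairs n)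
    (hE' : E' ⊆ allPairs n) (h : graphOf E = graphOf E') : E = E' := by
  have h1 := congrArg SimpleGraph.edgeSet h
  rw [edgeSet_graphOf (not_isDiag_of_subset hE), edgeSet_graphOf (not_isDiag_of_subset hE')] at h1
  exact_mod_cast h1

theorem gnm_support_eq {n m : ℕ} :
    {G : SimpleGraph (Fin n) | G.edgeSet.ncard = m} =
      graphOf '' ((allPairs n).powersetCard m : Set (Finset (Sym2 (Fin n)))) := by
  ext G
  simp only [Set.mem_ofPred_eq, Set.mem_image, mem_coe, mem_powersetCard]
  constructor
  · intro h
    obtain ⟨E, hE, rfl, hEG⟩ := exists_graphOf_eq G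
    rw [← hEG, Set.ncard_coe_finset] at h
    exact ⟨E, ⟨hE, h⟩, rfl⟩
  · rintro ⟨E, ⟨hE, h⟩, rfl⟩
    rw [edgeSet_graphOf (not_isDiag_of_subset hE), Set.ncard_coe_finset, h]

theorem addRandomEdges_support_eq {n r : ℕ} {E : Finset (Sym2 (Fin n))} (hE : E ⊆ allPairs n) :
    {G : SimpleGraph (Fin n) | graphOf E ≤ G ∧ (G.edgeSet \ (graphOf E).edgeSet).ncard = r} =
      (fun F => graphOf (E ∪ F)) ''
        ((allPairs n \ E).powersetCard r : Set (Finset (Sym2 (Fin n)))) := by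
  ext G
  simp only [Set.mem_ofPred_eq, Set.mem_image, mem_coe, mem_powersetCard]
  rw [edgeSet_graphOf (not_isDiag_of_subset hE)]
  constructor
  · rintro ⟨hle, h⟩
    obtain ⟨E', hE', rfl, -⟩ := exists_graphOf_eq G
    have hsub : E ⊆ E' := by
      have := SimpleGraph.edgeSet_mono hle
      rw [edgeSet_graphOf (not_isDiag_of_subset hE),
        edgeSet_graphOf (not_isDiag_of_subset hE')] at this
      exact_mod_cast this
    rw [edgeSet_graphOf (not_isDiag_of_subset hE'), ← coe_sdiff, Set.ncard_coe_finset] at h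
    exact ⟨E' \ E, ⟨sdiff_subset_sdiff hE' le_rfl, h⟩, by rw [union_sdiff_of_subset hsub]⟩
  · rintro ⟨F, ⟨hF, h⟩, rfl⟩
    have hEF : E ∪ F ⊆ allPairs n := union_subset hE (hF.trans sdiff_subset)
    refine ⟨graphOf_mono subset_union_left, ?_⟩
    rw [edgeSet_graphOf (not_isDiag_of_subset hEF), ← coe_sdiff, Set.ncard_coe_finset,
      union_sdiff_left, sdiff_eq_self_of_disjoint, h]
    exact Finset.disjoint_left.mpr fun e he => (Finset.mem_sdiff.mp (hF he)).2

open Classical in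
/-- The loss probability as an average over edge sets. -/
theorem packingLossProb_eq {k n m : ℕ} (h : m + n ≤ n.choose 2) :
    packingLossProb k n m = ((n.choose 2).choose m : ℝ)⁻¹ *
      ∑ E ∈ (allPairs n).powersetCard m, (((n.choose 2 - m).choose n : ℝ)⁻¹ *
        #{F ∈ (allPairs n \ E).powersetCard n |
          CoreHasPacking (graphOf E) k ∧ ¬ CoreHasPacking (graphOf (E ∪ F)) k}) := by
  have hcardE : ∀ E ∈ (allPairs n).powersetCard m, #(allPairs n \ E) = n.choose 2 - m := by
    intro E hE
    obtain ⟨h1, h2⟩ := mem_powersetCard.mp hE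
    rw [card_sdiff_of_subset h1, card_allPairs, h2]
  have hne : ((allPairs n).powersetCard m).Nonempty :=
    powersetCard_nonempty.mpr (by rw [card_allPairs]; omega)
  rw [packingLossProb, sprinkledPair, PMF.toOuterMeasure_bind_apply, gnm,
    tsum_uniformOr_mul _ hne graphOf ?_ _ gnm_support_eq]
  · rw [ENNReal.toReal_mul, ENNReal.toReal_inv, card_powersetCard, card_allPairs,
      ENNReal.toReal_natCast]
    congr 1
    have hinner : ∀ E ∈ (allPairs n).powersetCard m,
        ((addRandomEdges (graphOf E) n).map fun G => (graphOf E, G)).toOuterMeasure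
          {p | CoreHasPacking p.1 k ∧ ¬ CoreHasPacking p.2 k} =
        (((n.choose 2 - m).choose n : ℕ) : ENNReal)⁻¹ *
          #{F ∈ (allPairs n \ E).powersetCard n |
            CoreHasPacking (graphOf E) k ∧ ¬ CoreHasPacking (graphOf (E ∪ F)) k} := by
      intro E hE
      have hE1 := (mem_powersetCard.mp hE).1
      have hne' : ((allPairs n \ E).powersetCard n).Nonempty :=
        powersetCard_nonempty.mpr (by rw [hcardE E hE]; omega)
      rw [PMF.toOuterMeasure_map_apply, addRandomEdges,
        toOuterMeasure_uniformOr _ hne' _ ?_ _ (addRandomEdges_support_eq hE1), card_powersetCard,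
        hcardE E hE]
      · simp only [Set.mem_preimage, Set.mem_ofPred_eq]
      · intro F hF F' hF' hFF'
        have hF1 := (mem_powersetCard.mp hF).1
        have hF1' := (mem_powersetCard.mp hF').1
        have heq := graphOf_injOn (union_subset hE1 (hF1.trans sdiff_subset))
          (union_subset hE1 (hF1'.trans sdiff_subset)) hFF'
        have hd : ∀ F₀ ⊆ allPairs n \ E, (E ∪ F₀) \ E = F₀ := fun F₀ hF₀ => by
          rw [union_sdiff_left, sdiff_eq_self_of_disjoint]
          exact Finset.disjoint_left.mpr fun e he => (Finset.mem_sdiff.mp (hF₀ he)).2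
        rw [← hd F hF1, ← hd F' hF1', heq]
    rw [sum_congr rfl hinner, ENNReal.toReal_sum]
    · refine sum_congr rfl fun E _ => ?_
      rw [ENNReal.toReal_mul, ENNReal.toReal_inv, ENNReal.toReal_natCast, ENNReal.toReal_natCast]
    · intro E _
      refine ENNReal.mul_ne_top (ENNReal.inv_ne_top.mpr ?_) (ENNReal.natCast_ne_top _)
      exact_mod_cast (Nat.choose_pos (by omega)).ne'
  · intro E hE E' hE' hEE'
    exact graphOf_injOn (mem_powersetCard.mp hE).1 (mem_powersetCard.mp hE').1 hEE'

/-- Choosing `m` and then `r` further elements yields a uniformly random set of size `m + r`. -/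
theorem sum_card_filter_union {α : Type*} [DecidableEq α] (U : Finset α) (m r : ℕ)
    (q : Finset α → Prop) [DecidablePred q] :
    ∑ E ∈ U.powersetCard m, #{F ∈ (U \ E).powersetCard r | q (E ∪ F)} =
      (m + r).choose m * #{G ∈ U.powersetCard (m + r) | q G} := by
  have h1 : ∑ E ∈ U.powersetCard m, #{F ∈ (U \ E).powersetCard r | q (E ∪ F)} =
      ∑ G ∈ U.powersetCard (m + r) with q G, #(G.powersetCard m) := by
    rw [← card_sigma, ← card_sigma]
    refine Finset.card_bij' (fun p _ => ⟨p.1 ∪ p.2, p.1⟩) (fun p _ => ⟨p.2, p.1 \ p.2⟩)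
      ?_ ?_ ?_ ?_
    · rintro ⟨E, F⟩ hp
      simp only [mem_sigma, mem_filter, mem_powersetCard] at hp ⊢
      obtain ⟨⟨h1, h2⟩, ⟨h3, h4⟩, h5⟩ := hp
      have hd : Disjoint E F := Finset.disjoint_right.mpr fun e he =>
        (Finset.mem_sdiff.mp (h3 he)).2
      refine ⟨⟨⟨union_subset h1 (h3.trans sdiff_subset), ?_⟩, h5⟩, subset_union_left, h2⟩
      rw [card_union_of_disjoint hd, h2, h4]
    · rintro ⟨G, E⟩ hp
      simp only [mem_sigma, mem_filter, mem_powersetCard] at hp ⊢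
      obtain ⟨⟨⟨h1, h2⟩, h3⟩, h4, h5⟩ := hp
      refine ⟨⟨h4.trans h1, h5⟩, ⟨sdiff_subset_sdiff h1 le_rfl, ?_⟩, ?_⟩
      · rw [card_sdiff_of_subset h4, h2, h5]; omega
      · rwa [union_sdiff_of_subset h4]
    · rintro ⟨E, F⟩ hp
      simp only [mem_sigma, mem_filter, mem_powersetCard] at hp
      have hd : Disjoint F E := Finset.disjoint_left.mpr fun e he =>
        (Finset.mem_sdiff.mp (hp.2.1.1 he)).2
      simp [union_sdiff_left, sdiff_eq_self_of_disjoint hd]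
    · rintro ⟨G, E⟩ hp
      simp only [mem_sigma, mem_filter, mem_powersetCard] at hp
      simp [union_sdiff_of_subset hp.2.1]
  rw [h1, sum_congr rfl (g := fun _ => (m + r).choose m), sum_const, smul_eq_mul, mul_comm]
  intro G hG
  rw [card_powersetCard, (mem_powersetCard.mp (mem_filter.mp hG).1).2]

open Classical in
/-- The number of edges touching the complement of the core `W` is at most `D * n`. -/
theorem card_filter_not_subset_le {n D : ℕ} {W : Finset (Fin n)} (hW : n ≤ #W + D)
    (U : Finset (Sym2 (Fin n))) : #{e ∈ U | ¬ ∀ x ∈ e, x ∈ W} ≤ D * n := by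
  have hsub : {e ∈ U | ¬ ∀ x ∈ e, x ∈ W} ⊆ (Wᶜ ×ˢ univ).image fun q => s(q.1, q.2) := by
    intro e he
    have := (mem_filter.mp he).2
    push Not at this
    obtain ⟨x, hx, hxW⟩ := this
    obtain ⟨y, rfl⟩ := Sym2.mem_iff_exists.mp hx
    exact mem_image.mpr ⟨(x, y), by simpa using hxW, rfl⟩
  refine (card_le_card hsub).trans (card_image_le.trans ?_)
  rw [card_product, card_compl, Fintype.card_fin, card_univ, Fintype.card_fin]
  exact Nat.mul_le_mul_right _ (by omega)

open Classical in
/-- The two ways in which adding edges to a graph with a large core can destroy the packing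
although the result is locally sparse: either many of the new edges leave the core, or the sprinkled
edges inside the core fail to repair the packing. -/
theorem card_loss_le {k n m D L : ℕ} {β : ℝ} {E : Finset (Sym2 (Fin n))}
    (hE : E ∈ (allPairs n).powersetCard m) (h : m + n ≤ n.choose 2) (hk : 3 ≤ k)
    (hW : n ≤ #(coreSet (graphOf E) k) + D) (hnD : D + 3 ≤ n) (hD : D ≤ L / 3)
    (hDn : 15 * (D * n : ℝ) ≤ (n.choose 2 - m : ℕ)) (hβ0 : 0 ≤ β) (hβ1 : β ≤ 1)
    (hβ : 2 * (β * n.choose 2 + (k - 3) / 2 * n) ≤ ((L / 3 + 1 : ℕ) - D : ℝ) ^ 2) :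
    (#{F ∈ (allPairs n \ E).powersetCard n | LocallySparse (E ∪ F) L ∧
      CoreHasPacking (graphOf E) k ∧ ¬ CoreHasPacking (graphOf (E ∪ F)) k} : ℝ) ≤
      (n.choose 2 - m).choose n * ((1 / 2) ^ n +
        Real.exp (k / 2 * (D + 1) - β * n / 4)) := by
  obtain ⟨hE1, hE2⟩ := mem_powersetCard.mp hE
  have hEd := not_isDiag_of_subset hE1
  set W := coreSet (graphOf E) k with hWdef
  set U := allPairs n \ E with hU
  have hUc : #U = n.choose 2 - m := by
    rw [hU, card_sdiff_of_subset hE1, card_allPairs, hE2]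
  set A : Finset (Sym2 (Fin n)) := {e ∈ U | ¬ ∀ x ∈ e, x ∈ W} with hA
  have hAU : A ⊆ U := filter_subset _ _
  have hAc : #A ≤ D * n := card_filter_not_subset_le hW U
  set j := (n + 1) / 2 with hj
  -- many new edges outside the core: as at most one pair in fifteen leaves
  -- the core, the exponential moment with base `16` suffices
  have h1 : (#{F ∈ U.powersetCard n | j ≤ #(F ∩ A)} : ℝ) ≤
      (n.choose 2 - m).choose n * (1 / 2) ^ n := by
    have h2 := card_le_inter_le U A hAU 16 (by norm_num) n j (by omega)
    rw [hUc] at h2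
    refine h2.trans ?_
    have hu0 : (0 : ℝ) < (n.choose 2 - m : ℕ) := by
      exact_mod_cast (by omega : 0 < n.choose 2 - m)
    have h3 : (#A : ℝ) / (n.choose 2 - m : ℕ) ≤ 1 / 15 := by
      rw [div_le_iff₀ hu0]
      have : (#A : ℝ) ≤ D * n := by exact_mod_cast hAc
      linarith
    have h4 : (1 + (16 - 1) * ((#A : ℝ) / (n.choose 2 - m : ℕ))) ^ n ≤ 2 ^ n := by
      refine pow_le_pow_left₀ (by positivity) (by linarith) n
    have h5 : ((16 : ℝ) ^ j)⁻¹ ≤ ((4 : ℝ) ^ n)⁻¹ := by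
      rw [show (16 : ℝ) = 4 ^ 2 by norm_num, ← pow_mul]
      refine inv_anti₀ (by positivity) (pow_le_pow_right₀ (by norm_num) (by omega))
    have h6 : (2 : ℝ) ^ n * ((4 : ℝ) ^ n)⁻¹ = (1 / 2) ^ n := by
      rw [← inv_pow, ← mul_pow]; norm_num
    rw [← h6]
    gcongr
  -- few new edges outside the core
  have h2 : (#{F ∈ U.powersetCard n | #(F ∩ A) < j ∧ LocallySparse (E ∪ F) L ∧
      CoreHasPacking (graphOf E) k ∧ ¬ CoreHasPacking (graphOf (E ∪ F)) k} : ℝ) ≤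
      Real.exp (k / 2 * (D + 1) - β * n / 4) * (n.choose 2 - m).choose n := by
    rw [← hUc]
    refine card_filter_le_of_fiber U A n _ _ fun F₁ hF₁ hF₁n => ?_
    have hUA : ∀ e, e ∈ U \ A ↔ e ∉ E ∧ ¬ e.IsDiag ∧ ∀ x ∈ e, x ∈ W := by
      intro e
      simp only [hA, hU, Finset.mem_sdiff, mem_filter, mem_allPairs]
      tauto
    by_cases hemp : {F₂ ∈ (U \ A).powersetCard (n - #F₁) | #((F₁ ∪ F₂) ∩ A) < j ∧
        LocallySparse (E ∪ (F₁ ∪ F₂)) L ∧ CoreHasPacking (graphOf E) k ∧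
        ¬ CoreHasPacking (graphOf (E ∪ (F₁ ∪ F₂))) k} = ∅
    · rw [hemp]; simp only [card_empty, Nat.cast_zero]; positivity
    obtain ⟨F₂, hF₂⟩ := nonempty_iff_ne_empty.mpr hemp
    obtain ⟨-, hjF, hsp, hpk, -⟩ := mem_filter.mp hF₂
    have hF₁j : #F₁ < j := by
      refine lt_of_le_of_lt (card_le_card fun e he => ?_) hjF
      exact mem_inter.mpr ⟨mem_union_left _ he, (mem_inter.mp (hF₁ he)).2⟩
    have hsp' : LocallySparse (E ∪ F₁) L :=
      hsp.anti (union_subset_union_right subset_union_left)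
    have hW3 : 3 ≤ #W := by omega
    have hQc : (#(U \ A) : ℝ) ≤ n.choose 2 := by
      have : #(U \ A) ≤ n.choose 2 := by
        rw [← card_allPairs]
        exact card_le_card (sdiff_subset.trans sdiff_subset)
      exact_mod_cast this
    have hmain := card_sprinkle_fail_le (D := D) (β := β) (Q := U \ A) hEd (F₁ := F₁)
      (fun e he => by
        have := hU ▸ (mem_inter.mp (hF₁ he)).1
        exact mem_allPairs.mp (Finset.mem_sdiff.mp this).1) hk hsp' hpk hW3
      (by rw [Fintype.card_fin]; exact hW) hD hUA hβ0 hβ1 (by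
        rw [Fintype.card_fin]
        refine le_trans ?_ hβ
        gcongr) (n - #F₁)
    refine le_trans ?_ (hmain.trans ?_)
    · refine Nat.cast_le.mpr (card_le_card fun F hF => ?_)
      obtain ⟨h3, -, -, -, h4⟩ := mem_filter.mp hF
      exact mem_filter.mpr ⟨h3, by rwa [union_assoc]⟩
    · rw [mul_comm]
      gcongr
      set t := n - #F₁ with ht
      have ht2 : (n : ℝ) / 2 ≤ t := by
        have : n ≤ 2 * t := by omega
        have : (n : ℝ) ≤ 2 * t := by exact_mod_cast this
        linarith
      have e1 : (1 - β / 2) ^ t ≤ Real.exp (-(β * n / 4)) := by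
        calc (1 - β / 2) ^ t ≤ (Real.exp (-(β / 2))) ^ t := by
              refine pow_le_pow_left₀ (by linarith) ?_ t
              have := Real.add_one_le_exp (-(β / 2))
              linarith
          _ = Real.exp (t * (-(β / 2))) := by rw [Real.exp_nat_mul]
          _ ≤ _ := by
              refine Real.exp_le_exp.mpr ?_
              nlinarith
      have e2 : (2 : ℝ) ^ ((k - 3) / 2 * (D + 1)) ≤ Real.exp (k / 2 * (D + 1)) := by
        have h3 : (2 : ℝ) ≤ Real.exp 1 := by
          have := Real.add_one_le_exp (1 : ℝ); linarith
        calc (2 : ℝ) ^ ((k - 3) / 2 * (D + 1)) ≤ (Real.exp 1) ^ ((k - 3) / 2 * (D + 1)) := by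
              gcongr
          _ = Real.exp (((k - 3) / 2 * (D + 1) : ℕ) : ℝ) := by
              rw [← Real.exp_nat_mul, mul_one]
          _ ≤ _ := by
              refine Real.exp_le_exp.mpr ?_
              push_cast
              have : (((k - 3) / 2 : ℕ) : ℝ) ≤ k / 2 := by
                refine Nat.cast_div_le.trans ?_
                have : ((k - 3 : ℕ) : ℝ) ≤ k := by exact_mod_cast Nat.sub_le k 3
                push_cast
                linarith
              gcongr
      calc (1 - β / 2) ^ t * 2 ^ ((k - 3) / 2 * (D + 1))
          ≤ Real.exp (-(β * n / 4)) * Real.exp (k / 2 * (D + 1)) := by gcongr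
        _ = _ := by rw [← Real.exp_add]; congr 1; ring
  have hsub : {F ∈ U.powersetCard n | LocallySparse (E ∪ F) L ∧
      CoreHasPacking (graphOf E) k ∧ ¬ CoreHasPacking (graphOf (E ∪ F)) k} ⊆
      {F ∈ U.powersetCard n | j ≤ #(F ∩ A)} ∪
      {F ∈ U.powersetCard n | #(F ∩ A) < j ∧ LocallySparse (E ∪ F) L ∧
      CoreHasPacking (graphOf E) k ∧ ¬ CoreHasPacking (graphOf (E ∪ F)) k} := by
    intro F hF
    obtain ⟨h3, h4⟩ := mem_filter.mp hF
    rcases le_or_gt j #(F ∩ A) with h5 | h5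
    · exact mem_union_left _ (mem_filter.mpr ⟨h3, h5⟩)
    · exact mem_union_right _ (mem_filter.mpr ⟨h3, h5, h4⟩)
  have h3 : (#{F ∈ U.powersetCard n | LocallySparse (E ∪ F) L ∧
      CoreHasPacking (graphOf E) k ∧ ¬ CoreHasPacking (graphOf (E ∪ F)) k} : ℝ) ≤ _ :=
    Nat.cast_le.mpr ((card_le_card hsub).trans (card_union_le _ _))
  rw [Nat.cast_add] at h3
  linarith

open Classical in
/-- The loss probability is at most the sum of the probabilities that the core of `H` is small,
that `G` is not locally sparse, and that sprinkling fails. -/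
theorem packingLossProb_le {k n m D L : ℕ} {β : ℝ} (h : m + n ≤ n.choose 2) (hk : 3 ≤ k)
    (hnD : D + 3 ≤ n) (hD : D ≤ L / 3)
    (hDn : 15 * (D * n : ℝ) ≤ (n.choose 2 - m : ℕ)) (hβ0 : 0 ≤ β) (hβ1 : β ≤ 1)
    (hβ : 2 * (β * n.choose 2 + (k - 3) / 2 * n) ≤ ((L / 3 + 1 : ℕ) - D : ℝ) ^ 2) :
    packingLossProb k n m ≤
      #{E ∈ (allPairs n).powersetCard m | #(coreSet (graphOf E) k) + D < n} /
        (n.choose 2).choose m +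
      #{G ∈ (allPairs n).powersetCard (m + n) | ¬ LocallySparse G L} /
        (n.choose 2).choose (m + n) +
      ((1 / 2) ^ n + Real.exp (k / 2 * (D + 1) - β * n / 4)) := by
  rw [packingLossProb_eq h]
  set N := n.choose 2 with hN
  set PE := (allPairs n).powersetCard m with hPE
  set η := (1 / 2 : ℝ) ^ n + Real.exp (k / 2 * (D + 1) - β * n / 4) with hη
  have hη0 : 0 ≤ η := by positivity
  have hc1 : (0 : ℝ) < N.choose m := by exact_mod_cast Nat.choose_pos (by omega)
  have hc2 : (0 : ℝ) < (N - m).choose n := by exact_mod_cast Nat.choose_pos (by omega)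
  have hc3 : (0 : ℝ) < N.choose (m + n) := by exact_mod_cast Nat.choose_pos (by omega)
  have hc4 : (0 : ℝ) < (m + n).choose m := by exact_mod_cast Nat.choose_pos (by omega)
  have hUc : ∀ E ∈ PE, #(allPairs n \ E) = N - m := by
    intro E hE
    obtain ⟨h1, h2⟩ := mem_powersetCard.mp hE
    rw [card_sdiff_of_subset h1, card_allPairs, h2]
  have hterm : ∀ E ∈ PE, ((N - m).choose n : ℝ)⁻¹ * #{F ∈ (allPairs n \ E).powersetCard n |
        CoreHasPacking (graphOf E) k ∧ ¬ CoreHasPacking (graphOf (E ∪ F)) k} ≤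
      (if #(coreSet (graphOf E) k) + D < n then 1 else 0) +
      ((N - m).choose n : ℝ)⁻¹ *
        (#{F ∈ (allPairs n \ E).powersetCard n | ¬ LocallySparse (E ∪ F) L} : ℕ) + η := by
    intro E hE
    split_ifs with hcore
    · have h1 : (#{F ∈ (allPairs n \ E).powersetCard n |
          CoreHasPacking (graphOf E) k ∧ ¬ CoreHasPacking (graphOf (E ∪ F)) k} : ℝ) ≤
          (N - m).choose n := by
        refine Nat.cast_le.mpr ((card_filter_le _ _).trans ?_)
        rw [card_powersetCard, hUc E hE]
      have h2 : ((N - m).choose n : ℝ)⁻¹ * #{F ∈ (allPairs n \ E).powersetCard n |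
          CoreHasPacking (graphOf E) k ∧ ¬ CoreHasPacking (graphOf (E ∪ F)) k} ≤ 1 := by
        rw [inv_mul_le_iff₀ hc2]; simpa using h1
      have h3 : (0 : ℝ) ≤ ((N - m).choose n : ℝ)⁻¹ *
        (#{F ∈ (allPairs n \ E).powersetCard n | ¬ LocallySparse (E ∪ F) L} : ℕ) := by positivity
      linarith
    · have h1 := card_loss_le (β := β) hE h hk (by omega) hnD hD hDn hβ0 hβ1 hβ
      have hsub : {F ∈ (allPairs n \ E).powersetCard n |
          CoreHasPacking (graphOf E) k ∧ ¬ CoreHasPacking (graphOf (E ∪ F)) k} ⊆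
          {F ∈ (allPairs n \ E).powersetCard n | ¬ LocallySparse (E ∪ F) L} ∪
          {F ∈ (allPairs n \ E).powersetCard n | LocallySparse (E ∪ F) L ∧
          CoreHasPacking (graphOf E) k ∧ ¬ CoreHasPacking (graphOf (E ∪ F)) k} := by
        intro F hF
        obtain ⟨h3, h4⟩ := mem_filter.mp hF
        by_cases h5 : LocallySparse (E ∪ F) L
        · exact mem_union_right _ (mem_filter.mpr ⟨h3, h5, h4⟩)
        · exact mem_union_left _ (mem_filter.mpr ⟨h3, h5⟩)
      have h3 : (#{F ∈ (allPairs n \ E).powersetCard n |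
          CoreHasPacking (graphOf E) k ∧ ¬ CoreHasPacking (graphOf (E ∪ F)) k} : ℝ) ≤ _ :=
        Nat.cast_le.mpr ((card_le_card hsub).trans (card_union_le _ _))
      rw [Nat.cast_add] at h3
      rw [zero_add, inv_mul_le_iff₀ hc2, mul_add, mul_inv_cancel_left₀ hc2.ne']
      linarith
  have hs : ∑ E ∈ PE, (#{F ∈ (allPairs n \ E).powersetCard n | ¬ LocallySparse (E ∪ F) L} : ℝ) =
      (m + n).choose m * #{G ∈ (allPairs n).powersetCard (m + n) | ¬ LocallySparse G L} := by
    exact_mod_cast sum_card_filter_union (allPairs n) m n (fun G => ¬ LocallySparse G L)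
  have hcE : (#PE : ℝ) = N.choose m := by rw [hPE, card_powersetCard, card_allPairs]
  have hsum := sum_le_sum hterm
  simp only [sum_add_distrib, sum_boole, ← mul_sum, hs, sum_const, hcE, nsmul_eq_mul] at hsum
  have hid : ((m + n).choose m : ℝ) / (N - m).choose n = N.choose m / N.choose (m + n) := by
    rw [div_eq_div_iff hc2.ne' hc3.ne']
    have := Nat.choose_mul (n := N) (k := m + n) (s := m) (by omega)
    rw [Nat.add_sub_cancel_left] at this
    rw [mul_comm]
    exact_mod_cast this
  clear_value η
  rw [inv_mul_le_iff₀ hc1, ← mul_sum]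
  refine hsum.trans (le_of_eq ?_)
  rw [mul_add, mul_add, mul_div_cancel₀ _ hc1.ne', ← mul_assoc, inv_mul_eq_div, hid]
  ring

end Counting

/-! ### First moment estimates -/

section FirstMoment

theorem choose_le_three_mul_div_pow (a t : ℕ) (ht : 1 ≤ t) :
    (a.choose t : ℝ) ≤ (3 * a / t) ^ t := by
  have ht' : (0 : ℝ) < t := by exact_mod_cast ht
  have h1 : (a.choose t : ℝ) ≤ (a : ℝ) ^ t / t.factorial := Nat.choose_le_pow_div t a
  have h2 : (t : ℝ) ^ t / t.factorial ≤ Real.exp t := Real.pow_div_factorial_le_exp t ht'.le t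
  have h3 : Real.exp t ≤ 3 ^ t := by
    rw [show (t : ℝ) = t * 1 by ring, Real.exp_nat_mul]
    exact pow_le_pow_left₀ (Real.exp_pos _).le Real.exp_one_lt_three.le t
  have hf : (0 : ℝ) < t.factorial := by exact_mod_cast t.factorial_pos
  have h4 : (t : ℝ) ^ t ≤ 3 ^ t * t.factorial := by
    rw [div_le_iff₀ hf] at h2
    exact h2.trans (by gcongr)
  refine h1.trans ?_
  rw [div_pow, mul_pow, div_le_div_iff₀ hf (by positivity)]
  calc (a : ℝ) ^ t * t ^ t ≤ a ^ t * (3 ^ t * t.factorial) := by gcongr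
    _ = _ := by ring

open Classical in
/-- The number of pairs meeting a vertex set `X` is at least the number of those that leave it. -/
theorem card_mul_le_card_meeting {n : ℕ} (X : Finset (Fin n)) :
    #X * (n - #X) ≤ #{e ∈ allPairs n | ∃ v ∈ e, v ∈ X} := by
  have h1 : #(X ×ˢ Xᶜ) = #X * (n - #X) := by
    rw [card_product, card_compl, Fintype.card_fin]
  rw [← h1]
  refine Finset.card_le_card_of_injOn (fun q => s(q.1, q.2)) ?_ ?_
  · intro q hq
    obtain ⟨h2, h3⟩ := mem_product.mp hq
    rw [mem_compl] at h3
    refine mem_coe.mpr (mem_filter.mpr ⟨mem_allPairs.mpr ?_, q.1, Sym2.mem_mk_left _ _, h2⟩)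
    rw [Sym2.mk_isDiag_iff]
    exact fun h => h3 (h ▸ h2)
  · intro q hq q' hq' hqq'
    obtain ⟨h2, h3⟩ := mem_product.mp hq
    obtain ⟨h2', h3'⟩ := mem_product.mp hq'
    rw [mem_compl] at h3 h3'
    rcases Sym2.eq_iff.mp hqq' with ⟨h4, h5⟩ | ⟨h4, h5⟩
    · exact Prod.ext h4 h5
    · exact absurd (h4 ▸ h2) h3'

open Classical in
/-- If the core misses more than `D` vertices, then some set of `D + 1` vertices meets at most
`k * (D + 1)` edges; the expected number of such sets is bounded by means of an exponential
moment. -/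
theorem card_small_core_le {k n m D : ℕ} (hm : m ≤ n.choose 2) (hD : D + 1 ≤ n) {z : ℝ}
    (hz : 0 < z) (hz1 : z ≤ 1) :
    (#{E ∈ (allPairs n).powersetCard m | #(coreSet (graphOf E) k) + D < n} : ℝ) ≤
      (n.choose 2).choose m * (n.choose (D + 1) *
        (Real.exp (-((1 - z) * (m * ((D + 1 : ℕ) * (n - (D + 1 : ℕ))) / n.choose 2))) *
          (z ^ (k * (D + 1)))⁻¹)) := by
  set x := D + 1 with hx
  set N := n.choose 2 with hN
  set M : Finset (Fin n) → Finset (Sym2 (Fin n)) := fun X =>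
    {e ∈ allPairs n | ∃ v ∈ e, v ∈ X} with hM
  have hsub : {E ∈ (allPairs n).powersetCard m | #(coreSet (graphOf E) k) + D < n} ⊆
      ((univ : Finset (Fin n)).powersetCard x).biUnion fun X =>
        {E ∈ (allPairs n).powersetCard m | #(E ∩ M X) ≤ k * x} := by
    intro E hE
    obtain ⟨hEp, hcore⟩ := mem_filter.mp hE
    have hE1 := (mem_powersetCard.mp hEp).1
    obtain ⟨X, hX, -, hXc⟩ := exists_peeled (k := k) (E := E)
      (edgeSet_graphOf (not_isDiag_of_subset hE1)).symm x (by rw [Fintype.card_fin]; omega)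
    refine mem_biUnion.mpr ⟨X, mem_powersetCard.mpr ⟨subset_univ _, hX⟩,
      mem_filter.mpr ⟨hEp, le_trans (card_le_card ?_) hXc⟩⟩
    intro e he
    obtain ⟨h1, h2⟩ := mem_inter.mp he
    simp only [mem_filter]
    exact ⟨h1, (mem_filter.mp h2).2⟩
  have hterm : ∀ X ∈ (univ : Finset (Fin n)).powersetCard x,
      (#{E ∈ (allPairs n).powersetCard m | #(E ∩ M X) ≤ k * x} : ℝ) ≤
      N.choose m * (Real.exp (-((1 - z) * (m * ((x : ℕ) * (n - (x : ℕ))) / N))) *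
        (z ^ (k * x))⁻¹) := by
    intro X hX
    have hXc := (mem_powersetCard.mp hX).2
    have h1 := card_inter_le_le (allPairs n) (M X) (filter_subset _ _) z hz hz1 m (k * x)
      (by rw [card_allPairs]; exact hm)
    rw [card_allPairs] at h1
    refine h1.trans ?_
    have h2 : (x : ℝ) * (n - x) ≤ #(M X) := by
      have := card_mul_le_card_meeting X
      rw [hXc] at this
      rw [← Nat.cast_sub hD]
      exact_mod_cast this
    have h3 : (#(M X) : ℝ) ≤ N := by
      have : #(M X) ≤ N := by rw [hN, ← card_allPairs]; exact card_le_card (filter_subset _ _)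
      exact_mod_cast this
    have h4 : (#(M X) : ℝ) / N ≤ 1 := div_le_one_of_le₀ h3 (by positivity)
    have h5 : (1 + (z - 1) * ((#(M X) : ℝ) / N)) ^ m ≤
        Real.exp (-((1 - z) * (m * ((x : ℕ) * (n - (x : ℕ))) / N))) := by
      have h0 : 0 ≤ (#(M X) : ℝ) / N := by positivity
      calc (1 + (z - 1) * ((#(M X) : ℝ) / N)) ^ m
          ≤ (Real.exp ((z - 1) * ((#(M X) : ℝ) / N))) ^ m := by
            refine pow_le_pow_left₀ (by nlinarith) ?_ m
            have := Real.add_one_le_exp ((z - 1) * ((#(M X) : ℝ) / N))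
            linarith
        _ = Real.exp (m * ((z - 1) * ((#(M X) : ℝ) / N))) := by rw [Real.exp_nat_mul]
        _ ≤ _ := by
            refine Real.exp_le_exp.mpr ?_
            have h6 : (x : ℝ) * (n - x) / N ≤ #(M X) / N := by gcongr
            have h7 : (1 - z) * m * ((x : ℝ) * (n - x) / N) ≤ (1 - z) * m * (#(M X) / N) :=
              mul_le_mul_of_nonneg_left h6 (mul_nonneg (by linarith) (by positivity))
            have h8 : (1 - z) * (m * ((x : ℕ) * (n - (x : ℕ))) / N) =
              (1 - z) * m * ((x : ℝ) * (n - x) / N) := by ring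
            rw [h8]
            linarith
    gcongr
  have h1 : (#{E ∈ (allPairs n).powersetCard m | #(coreSet (graphOf E) k) + D < n} : ℝ) ≤
      ∑ X ∈ (univ : Finset (Fin n)).powersetCard x,
        (#{E ∈ (allPairs n).powersetCard m | #(E ∩ M X) ≤ k * x} : ℝ) := by
    exact_mod_cast (card_le_card hsub).trans card_biUnion_le
  refine h1.trans ((sum_le_sum hterm).trans (le_of_eq ?_))
  rw [sum_const, card_powersetCard, card_univ, Fintype.card_fin, nsmul_eq_mul]
  ring

open Classical in
theorem card_filter_subset_allPairs {n : ℕ} (T : Finset (Fin n)) :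
    #{e ∈ allPairs n | ∀ x ∈ e, x ∈ T} ≤ (#T).choose 2 := by
  rw [← Sym2.card_image_offDiag T]
  refine card_le_card fun e he => ?_
  obtain ⟨h1, h2⟩ := mem_filter.mp he
  induction e with
  | h x y =>
    refine mem_image.mpr ⟨(x, y), mem_offDiag.mpr ⟨h2 x (Sym2.mem_mk_left _ _),
      h2 y (Sym2.mem_mk_right _ _), ?_⟩, rfl⟩
    have := mem_allPairs.mp h1
    rwa [Sym2.mk_isDiag_iff] at this

open Classical in
/-- Union bound over vertex sets and edge sets witnessing that a random graph is not locally
sparse. -/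
theorem card_not_locallySparse_le {n M L : ℕ} (hM : M ≤ n.choose 2) :
    (#{G ∈ (allPairs n).powersetCard M | ¬ LocallySparse G L} : ℝ) ≤
      (n.choose 2).choose M * ∑ t ∈ range (L + 1), (n.choose t : ℝ) *
        ((t.choose 2).choose (t + 3 + t / 16) *
          ((M : ℝ) / n.choose 2) ^ (t + 3 + t / 16)) := by
  set N := n.choose 2 with hN
  set U : Finset (Fin n) → Finset (Sym2 (Fin n)) := fun T =>
    {e ∈ allPairs n | ∀ x ∈ e, x ∈ T} with hU
  have hsub : {G ∈ (allPairs n).powersetCard M | ¬ LocallySparse G L} ⊆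
      (range (L + 1)).biUnion fun t => ((univ : Finset (Fin n)).powersetCard t).biUnion fun T =>
        ((U T).powersetCard (t + 3 + t / 16)).biUnion fun S =>
          {G ∈ (allPairs n).powersetCard M | S ⊆ G} := by
    intro G hG
    obtain ⟨hGp, hG⟩ := mem_filter.mp hG
    have hG1 := (mem_powersetCard.mp hGp).1
    simp only [LocallySparse, not_forall, not_lt] at hG
    obtain ⟨T, hT, hTG⟩ := hG
    obtain ⟨S, hS1, hS2⟩ := exists_subset_card_eq hTG
    have hS : ∀ e ∈ S, e ∈ G ∧ ∀ x ∈ e, x ∈ T := fun e he => by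
      have := hS1 he
      simpa only [mem_filter] using this
    refine mem_biUnion.mpr ⟨#T, mem_range.mpr (by omega), mem_biUnion.mpr ⟨T,
      mem_powersetCard.mpr ⟨subset_univ _, rfl⟩, mem_biUnion.mpr ⟨S, mem_powersetCard.mpr
      ⟨fun e he => ?_, hS2⟩, mem_filter.mpr ⟨hGp, fun e he => (hS e he).1⟩⟩⟩⟩
    exact mem_filter.mpr ⟨hG1 (hS e he).1, (hS e he).2⟩
  have h1 : (#{G ∈ (allPairs n).powersetCard M | ¬ LocallySparse G L} : ℝ) ≤
      ∑ t ∈ range (L + 1), ∑ T ∈ (univ : Finset (Fin n)).powersetCard t,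
        ∑ S ∈ (U T).powersetCard (t + 3 + t / 16),
          (#{G ∈ (allPairs n).powersetCard M | S ⊆ G} : ℝ) := by
    have h2 := (card_le_card hsub).trans (card_biUnion_le.trans (sum_le_sum fun t _ =>
      card_biUnion_le.trans (sum_le_sum fun T _ => card_biUnion_le)))
    exact_mod_cast h2
  refine h1.trans ?_
  rw [mul_sum]
  refine sum_le_sum fun t _ => ?_
  set e := t + 3 + t / 16 with he
  have h2 : ∀ T ∈ (univ : Finset (Fin n)).powersetCard t, ∑ S ∈ (U T).powersetCard e,
      (#{G ∈ (allPairs n).powersetCard M | S ⊆ G} : ℝ) ≤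
      (t.choose 2).choose e * (N.choose M * ((M : ℝ) / N) ^ e) := by
    intro T hT
    have hTc := (mem_powersetCard.mp hT).2
    have h3 : ∀ S ∈ (U T).powersetCard e,
        (#{G ∈ (allPairs n).powersetCard M | S ⊆ G} : ℝ) ≤ N.choose M * ((M : ℝ) / N) ^ e := by
      intro S hS
      have := card_superset_le (allPairs n) S M (by rw [card_allPairs]; exact hM)
      rwa [card_allPairs, (mem_powersetCard.mp hS).2] at this
    refine (sum_le_sum h3).trans ?_
    rw [sum_const, card_powersetCard, nsmul_eq_mul]
    have h4 : #(U T) ≤ t.choose 2 := hTc ▸ card_filter_subset_allPairs T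
    have h5 : ((#(U T)).choose e : ℝ) ≤ (t.choose 2).choose e := by
      exact_mod_cast Nat.choose_le_choose e h4
    gcongr
  refine (sum_le_sum h2).trans (le_of_eq ?_)
  rw [sum_const, card_powersetCard, card_univ, Fintype.card_fin, nsmul_eq_mul]
  ring

end FirstMoment

/-! ### Numerical estimates -/

section Numerics

/-- The exponent in the lower tail estimate for the number of edges that meet a vertex set beats the
entropy of choosing the set. -/
theorem log_le_chernoff_exponent {k c : ℝ} (hk : 10 ^ 17 ≤ k)
    (hc : k + 99 * Real.sqrt (k * Real.log k) ≤ c) :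
    75 * Real.log c ≤ c - 1 - k - k * Real.log ((c - 1) / k) := by
  have hk0 : 0 < k := by linarith
  have hlogk : 1 ≤ Real.log k := by
    rw [Real.le_log_iff_exp_le hk0]
    have := Real.exp_one_lt_three
    linarith
  set s := Real.sqrt (k * Real.log k) with hs
  have hs2 : s ^ 2 = k * Real.log k := Real.sq_sqrt (by positivity)
  have hs0 : 0 ≤ s := Real.sqrt_nonneg _
  have hs1 : 1 ≤ s := by
    by_contra hcon
    push Not at hcon
    nlinarith
  set w := c - 1 with hw
  have hwk : k ≤ w := by linarith
  have hw0 : 0 < w := by linarith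
  have hc0 : 0 < c := by linarith
  -- the quadratic lower bound for the excess
  have hquad : 300 * w * Real.log c ≤ (w - k) ^ 2 := by
    rcases le_total c (2 * k) with h2 | h2
    · have h3 : Real.log c ≤ 2 * Real.log k := by
        have h4 : c ≤ k ^ 2 := by nlinarith
        calc Real.log c ≤ Real.log (k ^ 2) := Real.log_le_log hc0 h4
          _ = 2 * Real.log k := by rw [Real.log_pow]; norm_num
      have h5 : 300 * w * Real.log c ≤ 300 * (2 * k) * (2 * Real.log k) := by
        have : 0 ≤ Real.log c := Real.log_nonneg (by linarith)
        gcongr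
        linarith
      have h6 : 98 * s ≤ w - k := by linarith
      have h7 : (98 * s) ^ 2 ≤ (w - k) ^ 2 := by gcongr
      nlinarith
    · set y := c - k with hy
      have hyk : k ≤ y := by linarith
      set v := Real.sqrt (2 * y) with hv
      have hv2 : v ^ 2 = 2 * y := Real.sq_sqrt (by linarith)
      have hv0 : 0 < v := Real.sqrt_pos.mpr (by linarith)
      have hv1 : 9600 ≤ v := by
        by_contra hcon
        push Not at hcon
        nlinarith
      have h3 : Real.log c ≤ 2 * v := by
        have h4 : Real.log v ≤ v - 1 := Real.log_le_sub_one_of_pos hv0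
        have h5 : Real.log c ≤ Real.log (v ^ 2) := Real.log_le_log hc0 (by rw [hv2]; linarith)
        rw [Real.log_pow] at h5
        push_cast at h5
        linarith
      have h5 : 300 * w * Real.log c ≤ 300 * v ^ 2 * (2 * v) := by
        have : 0 ≤ Real.log c := Real.log_nonneg (by linarith)
        gcongr
        rw [hv2]; linarith
      have h6 : v ^ 2 / 4 ≤ w - k := by rw [hv2]; linarith
      have h7 : (v ^ 2 / 4) ^ 2 ≤ (w - k) ^ 2 := by gcongr
      have h8 : 300 * v ^ 2 * (2 * v) ≤ (v ^ 2 / 4) ^ 2 := by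
        have : 0 ≤ v ^ 3 * (v - 9600) := mul_nonneg (by positivity) (by linarith)
        nlinarith
      linarith
  -- `log t ≤ 2 (√t - 1)` reduces the exponent to `(√w - √k) ^ 2`
  set a := Real.sqrt w with ha
  set b := Real.sqrt k with hb
  have ha2 : a ^ 2 = w := Real.sq_sqrt hw0.le
  have hb2 : b ^ 2 = k := Real.sq_sqrt hk0.le
  have ha0 : 0 < a := Real.sqrt_pos.mpr hw0
  have hb0 : 0 < b := Real.sqrt_pos.mpr hk0
  have hba : b ≤ a := Real.sqrt_le_sqrt hwk
  have hlog : Real.log (w / k) ≤ 2 * (a / b - 1) := by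
    rw [← ha2, ← hb2, ← div_pow, Real.log_pow]
    have := Real.log_le_sub_one_of_pos (div_pos ha0 hb0)
    push_cast
    linarith
  have h1 : k * Real.log (w / k) ≤ 2 * (a * b - k) := by
    calc k * Real.log (w / k) ≤ k * (2 * (a / b - 1)) := by gcongr
      _ = 2 * (a * b - k) := by rw [← hb2]; field_simp
  have h2 : (a - b) ^ 2 ≤ w - k - k * Real.log (w / k) := by nlinarith
  refine le_trans ?_ h2
  have h3 : (w - k) ^ 2 ≤ (a - b) ^ 2 * (4 * w) := by
    have h4 : w - k = (a - b) * (a + b) := by rw [← ha2, ← hb2]; ring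
    have h5 : (a + b) ^ 2 ≤ 4 * w := by nlinarith
    rw [h4, mul_pow]
    gcongr
  have h4 : (75 * Real.log c) * (4 * w) ≤ (a - b) ^ 2 * (4 * w) := by linarith
  exact le_of_mul_le_mul_right h4 (by linarith)

/-- Exponential decay in `t / 16`, rounded down, as exponential decay in `t`. -/
theorem half_pow_div_le (t : ℕ) : (1 / 2 : ℝ) ^ (t / 16) ≤ 2 * (31 / 32 : ℝ) ^ t := by
  obtain ⟨q, s, hs, rfl⟩ : ∃ q s, s < 16 ∧ t = 16 * q + s := ⟨t / 16, t % 16, by omega, by omega⟩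
  rw [show (16 * q + s) / 16 = q by omega, pow_add, pow_mul]
  have h1 : (1 / 2 : ℝ) ^ q ≤ ((31 / 32 : ℝ) ^ 16) ^ q := by
    gcongr; norm_num
  have h2 : (31 / 32 : ℝ) ^ 15 ≤ (31 / 32 : ℝ) ^ s :=
    pow_le_pow_of_le_one (by norm_num) (by norm_num) (by omega)
  have h3 : (1 / 2 : ℝ) ≤ (31 / 32 : ℝ) ^ 15 := by norm_num
  have h4 : (0 : ℝ) ≤ ((31 / 32 : ℝ) ^ 16) ^ q := by positivity
  nlinarith

/-- The value of the convergent series that bounds the expected number of small dense sets. -/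
noncomputable def sparseConst : ℝ := ∑' t : ℕ, (t : ℝ) ^ 3 * (2 * (31 / 32 : ℝ) ^ t)

theorem summable_sparseConst : Summable fun t : ℕ => (t : ℝ) ^ 3 * (2 * (31 / 32 : ℝ) ^ t) := by
  have := (summable_pow_mul_geometric_of_norm_lt_one (R := ℝ) 3 (r := 31 / 32)
    (by norm_num)).mul_left 2
  refine this.congr fun t => by ring

/-- The expected number of sets of `t` vertices spanning `t + 3 + t / 16` edges: the three edges
beyond `t + t / 16` account for the factor `n⁻³`. -/
theorem sparse_term_le {n t : ℕ} {c : ℝ} (hc : 10 ^ 17 ≤ c) (hn : 0 < n) (ht : t * c ^ 34 ≤ n) :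
    (n.choose t : ℝ) * ((t.choose 2).choose (t + 3 + t / 16) *
      (2 * c / n) ^ (t + 3 + t / 16)) ≤
      (3 * c) ^ 33 / n ^ 3 * ((t : ℝ) ^ 3 * (2 * (31 / 32 : ℝ) ^ t)) := by
  rcases Nat.eq_zero_or_pos t with h0 | h0
  · subst h0; simp
  have hn' : (0 : ℝ) < n := by exact_mod_cast hn
  have ht' : (0 : ℝ) < t := by exact_mod_cast h0
  have hc0 : 0 < c := by linarith
  set q := t / 16 with hq
  set e := t + 3 + q with he
  have he' : (0 : ℝ) < e := by exact_mod_cast (by omega : 0 < e)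
  have h1 : (n.choose t : ℝ) ≤ (3 * n / t) ^ t := choose_le_three_mul_div_pow n t h0
  have h2 : ((t.choose 2).choose e : ℝ) ≤ (3 * t / 2) ^ e := by
    refine (choose_le_three_mul_div_pow _ e (by omega)).trans ?_
    refine pow_le_pow_left₀ (by positivity) ?_ e
    rw [Nat.cast_choose_two, div_le_div_iff₀ he' (by norm_num)]
    have : (t : ℝ) ≤ e := by exact_mod_cast (by omega : t ≤ e)
    nlinarith [mul_pos ht' ht', mul_le_mul_of_nonneg_left this ht'.le]
  have h3 : (3 * (n : ℝ) / t) ^ t * ((3 * t / 2) ^ e * (2 * c / n) ^ e) =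
      3 ^ t * (3 * c) ^ e * ((t : ℝ) / n) ^ (3 + q) := by
    have e1 : (3 * t / 2) ^ e * (2 * c / n) ^ e = (3 * c) ^ e * ((t : ℝ) / n) ^ e := by
      rw [← mul_pow, ← mul_pow]; congr 1; field_simp
    have e2 : (3 * (n : ℝ) / t) ^ t = 3 ^ t * ((n : ℝ) / t) ^ t := by
      rw [← mul_pow]; congr 1; ring
    have e3 : ((n : ℝ) / t) ^ t * ((t : ℝ) / n) ^ e = ((t : ℝ) / n) ^ (3 + q) := by
      have h6 : (n : ℝ) / t * (t / n) = 1 := by field_simp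
      rw [he, add_assoc, pow_add, ← mul_assoc, ← mul_pow, h6, one_pow, one_mul]
    rw [e1, e2, ← e3]; ring
  have h4 : (3 : ℝ) ^ t * (3 * c) ^ e ≤ ((3 * c) ^ 33) ^ (q + 1) := by
    calc (3 : ℝ) ^ t * (3 * c) ^ e ≤ (3 * c) ^ t * (3 * c) ^ e := by
          gcongr; linarith
      _ = (3 * c) ^ (t + e) := (pow_add _ _ _).symm
      _ ≤ (3 * c) ^ (33 * (q + 1)) := pow_le_pow_right₀ (by linarith) (by omega)
      _ = _ := by rw [pow_mul]
  have h5 : (3 * c) ^ 33 * ((t : ℝ) / n) ≤ 1 / 2 := by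
    rw [← mul_div_assoc, div_le_div_iff₀ hn' (by norm_num), mul_pow]
    have e1 : (3 : ℝ) ^ 33 * 2 ≤ c := le_trans (by norm_num) hc
    calc (3 : ℝ) ^ 33 * c ^ 33 * t * 2 = (3 ^ 33 * 2) * (t * c ^ 33) := by ring
      _ ≤ c * (t * c ^ 33) := by gcongr
      _ = t * c ^ 34 := by ring
      _ ≤ 1 * n := by linarith
  calc (n.choose t : ℝ) * ((t.choose 2).choose e * (2 * c / n) ^ e)
      ≤ (3 * n / t) ^ t * ((3 * t / 2) ^ e * (2 * c / n) ^ e) := by gcongr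
    _ = 3 ^ t * (3 * c) ^ e * ((t : ℝ) / n) ^ (3 + q) := h3
    _ ≤ ((3 * c) ^ 33) ^ (q + 1) * ((t : ℝ) / n) ^ (3 + q) := by gcongr
    _ = (3 * c) ^ 33 * ((t : ℝ) / n) ^ 3 * ((3 * c) ^ 33 * ((t : ℝ) / n)) ^ q := by ring
    _ ≤ (3 * c) ^ 33 * ((t : ℝ) / n) ^ 3 * (1 / 2) ^ q := by gcongr
    _ ≤ (3 * c) ^ 33 * ((t : ℝ) / n) ^ 3 * (2 * (31 / 32 : ℝ) ^ t) := by
        gcongr; exact half_pow_div_le t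
    _ = _ := by rw [div_pow]; ring

/-- A random graph with `M` edges is locally sparse up to probability of order `c ^ 33 / n ^ 3`. -/
theorem sum_sparse_le {n M L : ℕ} {c : ℝ} (hc : 10 ^ 17 ≤ c) (hn : 0 < n) (hL : L * c ^ 34 ≤ n)
    (hM : (M : ℝ) / n.choose 2 ≤ 2 * c / n) :
    ∑ t ∈ range (L + 1), (n.choose t : ℝ) *
        ((t.choose 2).choose (t + 3 + t / 16) *
          ((M : ℝ) / n.choose 2) ^ (t + 3 + t / 16)) ≤ sparseConst * (3 * c) ^ 33 / n ^ 3 := by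
  have hc0 : 0 < c := by linarith
  have h1 : ∀ t ∈ range (L + 1), (n.choose t : ℝ) *
        ((t.choose 2).choose (t + 3 + t / 16) *
          ((M : ℝ) / n.choose 2) ^ (t + 3 + t / 16)) ≤
      (3 * c) ^ 33 / n ^ 3 * ((t : ℝ) ^ 3 * (2 * (31 / 32 : ℝ) ^ t)) := by
    intro t ht
    have htL : (t : ℝ) ≤ L := by
      exact_mod_cast Nat.lt_succ_iff.mp (mem_range.mp ht)
    refine le_trans ?_ (sparse_term_le hc hn (le_trans (by gcongr) hL))
    gcongr
  refine (sum_le_sum h1).trans ?_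
  rw [← mul_sum]
  have h2 : ∑ t ∈ range (L + 1), (t : ℝ) ^ 3 * (2 * (31 / 32 : ℝ) ^ t) ≤ sparseConst :=
    summable_sparseConst.sum_le_tsum _ fun t _ => by positivity
  calc (3 * c) ^ 33 / (n : ℝ) ^ 3 * ∑ t ∈ range (L + 1), (t : ℝ) ^ 3 * (2 * (31 / 32 : ℝ) ^ t)
      ≤ (3 * c) ^ 33 / (n : ℝ) ^ 3 * sparseConst := by gcongr
    _ = _ := by ring

/-- The core misses more than `D` vertices only with exponentially small probability. -/
theorem small_core_bound_le {k n m x : ℕ} {c : ℝ} (hk : (10 : ℝ) ^ 17 ≤ k)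
    (hc : k + 99 * Real.sqrt (k * Real.log k) ≤ c) (hx : 1 ≤ x)
    (hnx : (n : ℝ) ≤ x * c ^ 71)
    (hm : (c - 1) * n.choose 2 ≤ m * (n - x)) (hN : 0 < n.choose 2) :
    (n.choose x : ℝ) *
      (Real.exp (-((1 - k / (c - 1)) * (m * (x * (n - x)) / n.choose 2))) *
        (((k : ℝ) / (c - 1)) ^ (k * x))⁻¹) ≤ Real.exp (-x) := by
  have hexp := log_le_chernoff_exponent hk hc
  have hs0 := Real.sqrt_nonneg ((k : ℝ) * Real.log k)
  have hk0 : (0 : ℝ) < k := by linarith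
  have hlogk : 1 ≤ Real.log k := by
    rw [Real.le_log_iff_exp_le hk0]
    have := Real.exp_one_lt_three
    linarith
  have hs1 : 1 ≤ Real.sqrt ((k : ℝ) * Real.log k) := by
    rw [Real.one_le_sqrt]; nlinarith
  have hwk : (k : ℝ) ≤ c - 1 := by linarith
  have hw0 : 0 < c - 1 := by linarith
  have hc0 : 0 < c := by linarith
  have hx0 : (0 : ℝ) < x := by exact_mod_cast hx
  have hN0 : (0 : ℝ) < n.choose 2 := by exact_mod_cast hN
  have hlogc : 1 ≤ Real.log c := hlogk.trans (Real.log_le_log hk0 (by linarith))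
  have h1 : (n.choose x : ℝ) ≤ Real.exp (x * (72 * Real.log c)) := by
    refine (choose_le_three_mul_div_pow n x hx).trans ?_
    rw [Real.exp_nat_mul]
    refine pow_le_pow_left₀ (by positivity) ?_ x
    have h2 : Real.exp (72 * Real.log c) = c ^ 72 := by
      rw [mul_comm, Real.exp_mul, Real.exp_log hc0]
      exact_mod_cast Real.rpow_natCast c 72
    rw [h2, div_le_iff₀ hx0]
    calc 3 * (n : ℝ) ≤ 3 * (x * c ^ 71) := by gcongr
      _ ≤ c * (x * c ^ 71) := by gcongr; linarith only [hk, hwk]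
      _ = c ^ 72 * x := by ring
  have h2 : Real.exp (-((1 - k / (c - 1)) * (m * (x * (n - x)) / n.choose 2))) ≤
      Real.exp (-(x * (c - 1 - k))) := by
    refine Real.exp_le_exp.mpr (neg_le_neg ?_)
    have h3 : x * (c - 1) ≤ m * (x * (n - x)) / n.choose 2 := by
      rw [le_div_iff₀ hN0]
      nlinarith
    have h4 : 0 ≤ 1 - k / (c - 1) := by
      rw [sub_nonneg, div_le_one hw0]; exact hwk
    calc x * (c - 1 - k) = (1 - k / (c - 1)) * (x * (c - 1)) := by field_simp
      _ ≤ _ := by gcongr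
  have h3 : (((k : ℝ) / (c - 1)) ^ (k * x))⁻¹ = Real.exp (x * (k * Real.log ((c - 1) / k))) := by
    rw [← inv_pow, inv_div, mul_comm k x, pow_mul, pow_right_comm, Real.exp_nat_mul,
      Real.exp_nat_mul, Real.exp_log (by positivity), pow_right_comm]
  rw [h3]
  calc (n.choose x : ℝ) * (Real.exp (-((1 - k / (c - 1)) * (m * (x * (n - x)) / n.choose 2))) *
        Real.exp (x * (k * Real.log ((c - 1) / k))))
      ≤ Real.exp (x * (72 * Real.log c)) * (Real.exp (-(x * (c - 1 - k))) *
        Real.exp (x * (k * Real.log ((c - 1) / k)))) := by gcongr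
    _ = Real.exp (x * (72 * Real.log c - (c - 1 - k - k * Real.log ((c - 1) / k)))) := by
        rw [← Real.exp_add, ← Real.exp_add]; congr 1; ring
    _ ≤ _ := by
        refine Real.exp_le_exp.mpr ?_
        nlinarith

end Numerics

/-! ### Choice of the parameters -/

section Parameters

/-- The exponent in the failure probability of the sprinkling: at least `n / 2` new edges inside the
core, each improving the tracks with probability at least `β`, contribute `β * n / 4`, which by far
exceeds the number of improvements needed. -/
theorem booster_exponent_le {k c y β D n : ℝ} (hck : k ≤ c) (hc : 10 ^ 17 ≤ c)
    (hβ : β * (32 * c ^ 68) = 1) (hyn : y * c ^ 71 = n) (hy : 1 ≤ y) (hD0 : 0 ≤ D) (hD : D ≤ y) :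
    k / 2 * (D + 1) - β * n / 4 ≤ -y := by
  have hc0 : 0 < c := by linarith
  have h1 : β * n = y * c ^ 3 / 32 := by
    rw [← hyn]
    linear_combination (y * c ^ 3 / 32) * hβ
  have h2 : k / 2 * (D + 1) ≤ c / 2 * (y + 1) := by gcongr
  have h3 : c / 2 * (y + 1) ≤ c * y := by nlinarith
  have h4 : 256 * (c * y) ≤ y * c ^ 3 := by
    have : (256 : ℝ) ≤ c ^ 2 := by nlinarith
    calc 256 * (c * y) ≤ c ^ 2 * (c * y) := by gcongr
      _ = _ := by ring
  have h5 : y ≤ c * y := le_mul_of_one_le_left (by linarith) (by linarith)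
  rw [h1]
  linarith

theorem half_pow_le_exp {n : ℕ} {y : ℝ} (h : y ≤ n / 2) : (1 / 2 : ℝ) ^ n ≤ Real.exp (-y) := by
  have h1 : (1 / 2 : ℝ) ≤ Real.exp (-(1 / 2)) := by
    have := Real.add_one_le_exp (-(1 / 2) : ℝ)
    linarith
  calc (1 / 2 : ℝ) ^ n ≤ (Real.exp (-(1 / 2))) ^ n := by gcongr
    _ = Real.exp (n * (-(1 / 2))) := by rw [Real.exp_nat_mul]
    _ ≤ Real.exp (-y) := Real.exp_le_exp.mpr (by linarith)

/-- With `l` the expansion range and `D` the number of vertices outside the core, expansion provides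
`(l - D) ^ 2 / 2` pairs of end vertices; a `β`-fraction of all pairs remains after discarding those
used by the tracks. -/
theorem booster_count_le {k c u β n D l : ℝ} (hck : k ≤ c) (hc : 10 ^ 17 ≤ c)
    (hβ : β * (32 * c ^ 68) = 1) (hun : u * c ^ 34 = n) (hcu : c * n * 10 ^ 17 ≤ u ^ 2)
    (hu : 0 ≤ u) (hn : 0 ≤ n) (hl : u / 3 ≤ l) (hD : 12 * D ≤ u) :
    2 * (β * (n * (n - 1) / 2) + (k - 3) / 2 * n) ≤ (l - D) ^ 2 := by
  have hc0 : 0 < c := by linarith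
  have hβ0 : 0 ≤ β := by
    by_contra hcon
    have : β * (32 * c ^ 68) < 0 := mul_neg_of_neg_of_pos (by linarith) (by positivity)
    linarith
  have h2 : (u / 4) ^ 2 ≤ (l - D) ^ 2 := by
    gcongr
    linarith
  have h3 : β * (n * (n - 1) / 2) ≤ u ^ 2 / 64 := by
    calc β * (n * (n - 1) / 2) ≤ β * (n ^ 2 / 2) := by
          gcongr
          nlinarith
      _ = u ^ 2 / 64 := by
          rw [← hun]
          linear_combination (u ^ 2 / 64) * hβ
  have h4 : (k - 3) * n ≤ c * n := by gcongr; linarith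
  nlinarith [sq_nonneg u]

/-- In a random graph with `m` edges, the mean number of edges leaving a set of `x` vertices is at
least `(c - 1) * x`. -/
theorem core_edge_count_le {n m x c : ℝ} (hc : 1 ≤ c) (hm : c * n / 2 ≤ m + 1)
    (hx : x * c ≤ n / 2) (hx1 : 1 ≤ x) (hxn : x ≤ n) (hcn : 4 * c ≤ n) :
    (c - 1) * (n * (n - 1) / 2) ≤ m * (n - x) := by
  have h3 : (c * n / 2 - 1) * (n - x) ≤ m * (n - x) := by
    have : 0 ≤ n - x := by linarith
    gcongr
    linarith
  refine le_trans ?_ h3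
  have h4 : x * c * n ≤ n / 2 * n := by gcongr; linarith
  nlinarith

theorem edge_density_le {n M c : ℝ} (hc : 10 ≤ c) (hn : 10 ≤ n) (hM : M ≤ c * n / 2 + n) :
    M / (n * (n - 1) / 2) ≤ 2 * c / n := by
  rw [div_le_div_iff₀ (by nlinarith) (by linarith)]
  have h2 : M * n ≤ (c * n / 2 + n) * n := by gcongr
  have h3 : 0 ≤ n * ((c - 2) * (n - 2) / 2 - 2) := by
    have : 8 * 8 ≤ (c - 2) * (n - 2) := by gcongr <;> linarith
    exact mul_nonneg (by linarith) (by linarith)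
  nlinarith

end Parameters

set_option maxHeartbeats 800000 in
open Classical in
/-- The loss probability for all sufficiently large `n`, with parameters polynomial in `c`. -/
theorem packingLossProb_le_of_pow_le {k n : ℕ} {c : ℝ} (hk : (10 : ℝ) ^ 17 ≤ k)
    (hc : k + 99 * Real.sqrt (k * Real.log k) ≤ c) (hn : c ^ 144 ≤ n) :
    packingLossProb k n ⌊c * n / 2⌋₊ ≤
      sparseConst * (3 * c) ^ 33 / n ^ 3 + 3 * Real.exp (-(n / c ^ 71)) := by
  have hk0 : (0 : ℝ) < k := lt_of_lt_of_le (by norm_num) hk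
  have hk3 : (3 : ℝ) ≤ k := le_trans (by norm_num) hk
  have hlogk : 1 ≤ Real.log k := by
    rw [Real.le_log_iff_exp_le hk0]
    have := Real.exp_one_lt_three
    linarith
  have hs1 : 1 ≤ Real.sqrt ((k : ℝ) * Real.log k) := by
    rw [Real.one_le_sqrt]; nlinarith
  have hwk : (k : ℝ) ≤ c - 1 := by linarith
  have hck : (k : ℝ) ≤ c := by linarith
  have hc17 : (10 : ℝ) ^ 17 ≤ c := hk.trans hck
  have hc1 : 1 ≤ c := le_trans (by norm_num) hc17
  have hc0 : 0 < c := by linarith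
  -- `n` dominates all powers of `c` that occur
  have hpow : ∀ j, j ≤ 143 → 10 ^ 17 * c ^ j ≤ (n : ℝ) := by
    intro j hj
    have h1 : c ^ j ≤ c ^ 143 := pow_le_pow_right₀ hc1 hj
    calc (10 : ℝ) ^ 17 * c ^ j ≤ c * c ^ 143 := mul_le_mul hc17 h1 (by positivity) hc0.le
      _ = c ^ 144 := (pow_succ' c 143).symm
      _ ≤ n := hn
  have hcn : 10 ^ 17 * c ≤ (n : ℝ) := by simpa only [pow_one] using hpow 1 (by norm_num)
  have hn17 : (10 : ℝ) ^ 34 ≤ n := by linarith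
  have hn0 : (0 : ℝ) < n := by linarith
  have hnN : 0 < n := by exact_mod_cast hn0
  -- `y` bounds the number of vertices outside the core of `H`, `u` is the size up to which vertex
  -- sets are sparse, and `β` is the fraction of pairs that improve the tracks
  obtain ⟨y, hy⟩ : ∃ y, y = (n : ℝ) / c ^ 71 := ⟨_, rfl⟩
  obtain ⟨u, hu⟩ : ∃ u, u = (n : ℝ) / c ^ 34 := ⟨_, rfl⟩
  obtain ⟨β, hβ⟩ : ∃ β, β = 1 / (32 * c ^ 68) := ⟨_, rfl⟩
  rw [← hy]
  have hyn : y * c ^ 71 = n := by rw [hy, div_mul_cancel₀ _ (by positivity)]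
  have hun : u * c ^ 34 = n := by rw [hu, div_mul_cancel₀ _ (by positivity)]
  have hβc : β * (32 * c ^ 68) = 1 := by rw [hβ, div_mul_cancel₀ _ (by positivity)]
  have hy1 : 1 ≤ y := by
    rw [hy, le_div_iff₀ (by positivity)]
    have h1 := hpow 71 (by norm_num)
    have h3 : (0 : ℝ) < c ^ 71 := by positivity
    linarith
  have hu1 : 10 ^ 17 ≤ u := by
    rw [hu, le_div_iff₀ (by positivity)]; exact hpow 34 (by norm_num)
  have hβ0 : 0 ≤ β := by rw [hβ]; positivity
  have hβ1 : β ≤ 1 := by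
    rw [hβ, div_le_one (by positivity)]
    have := one_le_pow₀ hc1 (n := 68)
    linarith
  have hyu : 10 ^ 17 * y ≤ u := by
    have h1 : y * c ^ 37 = u := by
      rw [hu, hy, div_mul_eq_mul_div, div_eq_div_iff (by positivity) (by positivity)]; ring
    have h2 : c ≤ c ^ 37 := le_self_pow₀ hc1 (by norm_num)
    rw [← h1, mul_comm y]
    gcongr
    linarith
  have hun' : 10 ^ 17 * u ≤ n := by
    have h2 : c ≤ c ^ 34 := le_self_pow₀ hc1 (by norm_num)
    rw [← hun, mul_comm u]
    gcongr
    linarith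
  have hyc : 10 ^ 17 * (y * c) ≤ n := by
    have h2 : c ≤ c ^ 70 := le_self_pow₀ hc1 (by norm_num)
    calc 10 ^ 17 * (y * c) ≤ c ^ 70 * (y * c) := by gcongr; linarith
      _ = y * c ^ 71 := by ring
      _ = n := hyn
  have hcu : c * n * 10 ^ 17 ≤ u ^ 2 := by
    rw [hu, div_pow, le_div_iff₀ (by positivity)]
    calc c * n * 10 ^ 17 * (c ^ 34) ^ 2 = (n : ℝ) * (10 ^ 17 * c ^ 69) := by ring
      _ ≤ (n : ℝ) * n := by gcongr; exact hpow 69 (by norm_num)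
      _ = (n : ℝ) ^ 2 := by ring
  clear hy hu hβ hn hpow
  obtain ⟨m, hm⟩ : ∃ m, m = ⌊c * n / 2⌋₊ := ⟨_, rfl⟩
  obtain ⟨L, hL⟩ : ∃ L, L = ⌊u⌋₊ := ⟨_, rfl⟩
  obtain ⟨D, hD⟩ : ∃ D, D = ⌊y⌋₊ := ⟨_, rfl⟩
  rw [← hm]
  have hm1 : (m : ℝ) ≤ c * n / 2 := hm ▸ Nat.floor_le (by positivity)
  have hm2 : c * n / 2 < m + 1 := hm ▸ Nat.lt_floor_add_one _
  have hL1 : (L : ℝ) ≤ u := hL ▸ Nat.floor_le (by linarith)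
  have hL2 : u < L + 1 := hL ▸ Nat.lt_floor_add_one _
  have hD1 : (D : ℝ) ≤ y := hD ▸ Nat.floor_le (by linarith)
  have hD2 : y < D + 1 := hD ▸ Nat.lt_floor_add_one _
  clear hm hL hD
  have hN : (n.choose 2 : ℝ) = n * (n - 1) / 2 := Nat.cast_choose_two ℝ n
  have hmn : m + n ≤ n.choose 2 := by
    have : ((m + n : ℕ) : ℝ) ≤ n.choose 2 := by
      rw [hN]; push_cast; nlinarith
    exact_mod_cast this
  have hL3 : u / 3 ≤ ((L / 3 + 1 : ℕ) : ℝ) := by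
    have h1 : L + 1 ≤ 3 * (L / 3 + 1) := by omega
    have h2 : ((L + 1 : ℕ) : ℝ) ≤ ((3 * (L / 3 + 1) : ℕ) : ℝ) := Nat.cast_le.mpr h1
    rw [Nat.cast_mul, Nat.cast_add_one L] at h2
    norm_num only at h2 ⊢
    linarith
  have hDL : D ≤ L / 3 := by
    have h1 : (D : ℝ) < ((L / 3 + 1 : ℕ) : ℝ) := by linarith
    exact Nat.lt_succ_iff.mp (Nat.cast_lt.mp h1)
  have hD3 : D + 3 ≤ n := by
    have : ((D + 3 : ℕ) : ℝ) ≤ n := by push_cast; linarith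
    exact_mod_cast this
  have hDn : 15 * (D * n : ℝ) ≤ (n.choose 2 - m : ℕ) := by
    rw [Nat.cast_sub (by omega), hN]
    have h1 : (D : ℝ) * n ≤ n / 100 * n := by
      gcongr; linarith
    nlinarith
  have hβL : 2 * (β * n.choose 2 + (k - 3) / 2 * n) ≤ ((L / 3 + 1 : ℕ) - D : ℝ) ^ 2 := by
    rw [hN]
    exact booster_count_le hck hc17 hβc hun hcu (by linarith) hn0.le hL3 (by linarith)
  refine (packingLossProb_le hmn (by exact_mod_cast hk3) hD3 hDL hDn hβ0 hβ1 hβL).trans ?_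
  have hcm : (0 : ℝ) < (n.choose 2).choose m := Nat.cast_pos.mpr (Nat.choose_pos (by omega))
  have hcM : (0 : ℝ) < (n.choose 2).choose (m + n) := Nat.cast_pos.mpr (Nat.choose_pos hmn)
  have hN0 : 0 < n.choose 2 := by omega
  have hx1 : ((D + 1 : ℕ) : ℝ) = D + 1 := Nat.cast_add_one D
  -- the core is large
  have hA : (#{E ∈ (allPairs n).powersetCard m | #(coreSet (graphOf E) k) + D < n} : ℝ) /
      (n.choose 2).choose m ≤ Real.exp (-y) := by
    rw [div_le_iff₀ hcm, mul_comm]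
    refine (card_small_core_le (k := k) (z := k / (c - 1)) (by omega) (by omega)
      (div_pos hk0 (by linarith)) ((div_le_one (by linarith)).mpr hwk)).trans ?_
    refine mul_le_mul_of_nonneg_left ?_ hcm.le
    refine (small_core_bound_le hk hc (by omega) ?_ ?_ hN0).trans ?_
    · rw [← hyn, hx1]
      gcongr
    · rw [hN, hx1]
      refine core_edge_count_le hc1 hm2.le ?_ ?_ ?_ ?_
      · have : (D : ℝ) * c ≤ y * c := by gcongr
        linarith
      · have : (0 : ℝ) ≤ D := Nat.cast_nonneg D
        linarith
      · linarith
      · linarith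
    · rw [hx1]
      exact Real.exp_le_exp.mpr (neg_le_neg hD2.le)
  -- the final graph is locally sparse
  have hB : (#{G ∈ (allPairs n).powersetCard (m + n) | ¬ LocallySparse G L} : ℝ) /
      (n.choose 2).choose (m + n) ≤ sparseConst * (3 * c) ^ 33 / n ^ 3 := by
    rw [div_le_iff₀ hcM, mul_comm]
    refine (card_not_locallySparse_le hmn).trans
      (mul_le_mul_of_nonneg_left (sum_sparse_le hc17 hnN ?_ ?_) hcM.le)
    · exact (mul_le_mul_of_nonneg_right hL1 (by positivity)).trans_eq hun
    · rw [hN, Nat.cast_add]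
      exact edge_density_le (by linarith) (by linarith) (by linarith)
  have hC : (1 / 2 : ℝ) ^ n ≤ Real.exp (-y) := half_pow_le_exp (by linarith)
  have hE : Real.exp (k / 2 * (D + 1) - β * n / 4) ≤ Real.exp (-y) :=
    Real.exp_le_exp.mpr
      (booster_exponent_le hck hc17 hβc hyn hy1 (Nat.cast_nonneg D) hD1)
  refine (add_le_add (add_le_add hA hB) (add_le_add hC hE)).trans_eq ?_
  ring

end CorePacking

theorem mainTheorem6 :
    ∃ k₀ : ℕ, ∀ k : ℕ, k₀ ≤ k → ∀ c : ℕ → ℝ,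
      (∀ᶠ n : ℕ in atTop,
        (k : ℝ) + 99 * Real.sqrt (k * Real.log k) ≤ c n ∧ c n ≤ 2 * Real.log n) →
      (fun n : ℕ => CorePacking.packingLossProb k n ⌊c n * n / 2⌋₊)
        =o[atTop] (fun n : ℕ => ((n : ℝ) ^ 2)⁻¹) := by
  refine ⟨10 ^ 17, fun k hk c hc => ?_⟩
  have hk' : (10 : ℝ) ^ 17 ≤ k := by exact_mod_cast hk
  have hlog : ∀ j : ℕ, Tendsto (fun n : ℕ => (2 * Real.log n) ^ j / (n : ℝ)) atTop (nhds 0) := by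
    intro j
    have h := ((Real.isLittleO_pow_log_id_atTop (n := j)).comp_tendsto
      tendsto_natCast_atTop_atTop).tendsto_div_nhds_zero.const_mul ((2 : ℝ) ^ j)
    rw [mul_zero] at h
    refine h.congr fun n => ?_
    simp only [Function.comp_apply, id_eq, mul_pow]
    ring
  -- the error terms after multiplication by `n ^ 2`
  have h1 : Tendsto (fun n : ℕ =>
      CorePacking.sparseConst * 3 ^ 33 * ((2 * Real.log n) ^ 33 / (n : ℝ)))
      atTop (nhds 0) := by simpa using (hlog 33).const_mul (CorePacking.sparseConst * 3 ^ 33)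
  have h2 : Tendsto (fun n : ℕ => 3 * (Real.sqrt n ^ 4 * Real.exp (-Real.sqrt n)))
      atTop (nhds 0) := by
    simpa using (((Real.tendsto_pow_mul_exp_neg_atTop_nhds_zero 4).comp
      (Real.tendsto_sqrt_atTop.comp tendsto_natCast_atTop_atTop)).const_mul (3 : ℝ))
  have h3 := h1.add h2
  rw [add_zero] at h3
  have hconst : 0 ≤ CorePacking.sparseConst := tsum_nonneg fun t => by positivity
  refine isLittleO_of_tendsto' ?_ ?_
  · filter_upwards [eventually_gt_atTop 0] with n hn h0
    have : (0 : ℝ) < n := by exact_mod_cast hn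
    exact absurd h0 (by positivity)
  refine squeeze_zero' (Eventually.of_forall fun n =>
    div_nonneg ENNReal.toReal_nonneg (by positivity)) ?_ h3
  filter_upwards [hc, eventually_gt_atTop 0, (hlog 144).eventually_le_const one_pos]
    with n ⟨hc1, hc2⟩ hn h144
  have hn0 : (0 : ℝ) < n := by exact_mod_cast hn
  have hs0 := Real.sqrt_nonneg ((k : ℝ) * Real.log k)
  have hc17 : (10 : ℝ) ^ 17 ≤ c n := by linarith
  have hc0 : 0 < c n := by linarith
  have hcn : c n ^ 144 ≤ n := by
    rw [div_le_one hn0] at h144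
    exact le_trans (by gcongr) h144
  have hbound := CorePacking.packingLossProb_le_of_pow_le hk' hc1 hcn
  rw [div_inv_eq_mul]
  have hs : Real.sqrt n ^ 2 = n := Real.sq_sqrt hn0.le
  have hsn : 0 < Real.sqrt n := Real.sqrt_pos.mpr hn0
  have he : Real.sqrt n ≤ n / c n ^ 71 := by
    rw [le_div_iff₀ (by positivity)]
    have h71 : c n ^ 71 ≤ Real.sqrt n := by
      refine Real.le_sqrt_of_sq_le ?_
      rw [← pow_mul]
      exact le_trans (pow_le_pow_right₀ (by linarith) (by norm_num)) hcn
    calc Real.sqrt n * c n ^ 71 ≤ Real.sqrt n * Real.sqrt n := by gcongr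
      _ = n := Real.mul_self_sqrt hn0.le
  calc CorePacking.packingLossProb k n ⌊c n * n / 2⌋₊ * (n : ℝ) ^ 2
      ≤ (CorePacking.sparseConst * (3 * c n) ^ 33 / n ^ 3 +
          3 * Real.exp (-(n / c n ^ 71))) * n ^ 2 := by
        gcongr
    _ = CorePacking.sparseConst * 3 ^ 33 * (c n ^ 33 / n) +
        3 * ((n : ℝ) ^ 2 * Real.exp (-(n / c n ^ 71))) := by
        rw [mul_pow]; field_simp
    _ ≤ CorePacking.sparseConst * 3 ^ 33 * ((2 * Real.log n) ^ 33 / n) +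
        3 * (Real.sqrt n ^ 4 * Real.exp (-Real.sqrt n)) := by
        rw [show Real.sqrt (n : ℝ) ^ 4 = (n : ℝ) ^ 2 by rw [← hs]; rw [Real.sqrt_sq hsn.le]; ring]
        gcongr
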